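/- **Setting.** Let $(X,\|\cdot\|)$ be a Banach space. A linear evolution process is a family $L(t,\tau)\in\mathcal L(X)$, $t\ge\tau$, with $L(t,t)=I$, $L(t,\tau)=L(t,s)L(s,\tau)$ for $t\ge s\ge\tau$, and $(t,\tau)\mapsto L(t,\tau)\eta$ continuous on $\{t\ge\tau\}$ for each $\eta\in X$. It has an exponential splitting with bound $M\ge1$, exponents $\gamma>\rho$ and bounded projections $Q(t)$, $t\in\mathbb R$, if for $t\ge\tau$: $Q(t)L(t,\tau)=L(t,\tau)Q(\tau)$; $L(t,\tau)$ restricts to an isomorphism $Q(\tau)X\to Q(t)X$, with inverse denoted $L(\tau,t)$; and $$e^{\gamma(t-\tau)}\|L(t,\tau)(I-Q(\tau))\|\le M\ \ (t\ge\tau),\qquad e^{\rho(t-\tau)}\|L(t,\tau)Q(\tau)\|\le M\ \ (t\le\tau).$$ Put $N(\tau)=Q(\tau)X$, $S(\tau)=(I-Q(\tau))X$, $$|x|_{N(\tau)}=\sup_{t\le\tau}e^{\rho(t-\tau)}\|L(t,\tau)x\|\ (x\in N(\tau)),\qquad |x|_{S(\tau)}=\sup_{t\ge\tau}e^{\gamma(t-\tau)}\|L(t,\tau)x\|\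 (x\in S(\tau)).$$ A norm $\Gamma$ on $\mathbb R^2$ is called admissible if $\Gamma(a,\cdot)$ and $\Gamma(\cdot,b)$ are nondecreasing on $[0,\infty)$ for all $a,b\ge0$. For such $\Gamma$ put $\|x\|_\tau=\Gamma(|Q(\tau)x|_{N(\tau)},|(I-Q(\tau))x|_{S(\tau)})$, $x\in X$. Let $\mathcal M(t)\subset X$, $t\in\mathbb R$, be a family of sets and let $T(t,\tau)\colon X\to X$, $t\ge\tau$, satisfy $T(t,t)=I$, $T(t,s)T(s,\tau)=T(t,\tau)$ for $t\geq s\geq\tau$, with $t\mapsto T(t,\tau)\eta$ continuous on $[\tau,\infty)$ for all $\tau,\eta$ (an evolution process). A global solution is a map $z\colon\mathbb R\to X$ with $T(t,\tau)z(\tau)=z(t)$ for all $t\ge\tau$. Let $\operatorname{dist}(A,B)=\sup_{a\in A}\inf_{b\in B}\|a-b\|$. The family $\{\mathcal M(t)\}$ is an invariant manifold for $T$ if (i) $T(t,\tau)\mathcal M(\tau)=\mathcal M(t)$ for $t\ge\tau$; (ii) there is $\omega\in\mathbb R$ such that for each bounded $U\subset X$ there are $t_*\ge0$, $K>0$ with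 $\operatorname{dist}(T(t,\tau)U,\mathcal M(t))\le Ke^{-\omega(t-\tau)}$ whenever $t-\tau\ge t_*$; (iii) each $\mathcal M(t)$ is the graph of a Lipschitz map from $Q(t)X$ to $(I-Q(t))X$. It is an inertial manifold if (ii) holds with some $\omega>0$. **Theorem.** Let $L$ be a linear evolution process on $X$ with an exponential splitting as above, and let $\Gamma$ be an admissible norm. Let $f\colon\mathbb R\times X\to X$ be continuous with $f(t,0)=0$ and, for some $L_1,L_2>0$ and all $t\in\mathbb R$, $u,v\in X$, $$|Q(t)(f(t,u)-f(t,v))|_{N(t)}\le L_1\|u-v\|_t,\qquad |(I-Q(t))(f(t,u)-f(t,v))|_{S(t)}\le L_2\|u-v\|_t .$$ Let $T$ be an evolution process with $T(t,\tau)\eta=L(t,\tau)\eta+\int_\tau^tL(t,s)f(s,T(s,\tau)\eta)\,ds$ for $t\ge\tau$, $\eta\in X$. Let $\sigma\in(\rho,\gamma)$ satisfy the gap condition $$\Gamma\Big(\frac{L_1}{\sigma-\rho},\frac{L_2}{\gamma-\sigma}\Big)<1 .$$ Then the sets $$\mathcal M(t)=\Big\{\eta\in X:\ \text{there is a global solution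 } z \text{ with } z(t)=\eta,\ \sup_{r\le t}e^{\sigma r}\|z(r)\|_r<\infty\Big\}$$ form an invariant manifold for $T$. Moreover, the equation $\gamma-\rho=L_1\Gamma(1,k)+L_2\Gamma(1/k,1)$ has a least solution $k=\kappa_\Sigma$ in $(0,\infty)$ (so $\kappa_\Sigma$ depends only on $\gamma,\rho,L_1,L_2,\Gamma$), it satisfies $0<\kappa_\Sigma<\frac{L_2}{L_1}\frac{\sigma-\rho}{\gamma-\sigma}$, and there is $\Sigma\colon\mathbb R\times X\to X$ such that, with $P_\Sigma(t)\eta:=Q(t)\eta+\Sigma(t,\eta)$: (I) $\mathcal M(t)=P_\Sigma(t)X=\{Q(t)\eta+\Sigma(t,Q(t)\eta):\eta\in X\}$, $\Sigma(\tau,\eta)=\Sigma(\tau,Q(\tau)\eta)=(I-Q(\tau))\Sigma(\tau,\eta)$, $\Sigma(\tau,0)=0$, and $|\Sigma(\tau,\eta)-\Sigma(\tau,\tilde\eta)|_{S(\tau)}\le\kappa_\Sigma|Q(\tau)(\eta-\tilde\eta)|_{N(\tau)}$ for all $\tau\in\mathbb R$, $\eta,\tilde\eta\in X$. (II) For $\tau\in\mathbb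 R$ and $\eta\in\mathcal M(\tau)$ there is a global solution $z$ with $z(\tau)=\eta$, $z(t)\in\mathcal M(t)$ for all $t\in\mathbb R$ and $\sup_{r\le\tau}e^{\sigma r}\|z(r)\|_r<\infty$. It is the only global solution through $z(\tau)=\eta$ that stays in $\{\mathcal M(t)\}$, and also the only one with $\sup_{r\le\tau}e^{\sigma r}\|z(r)\|_r<\infty$, and $$\|z(t)\|_t\le\frac{\Gamma(1,\kappa_\Sigma)}{\Gamma(1,0)}e^{-(\rho+L_1\Gamma(1,\kappa_\Sigma))(t-\tau)}\|\eta\|_\tau\quad\text{for } t\le\tau .$$ (III) With $\displaystyle \omega=\gamma-\frac{(\gamma-\rho)L_2\Gamma(0,1)}{\gamma-\rho-L_1\Gamma(1,\kappa_\Sigma)}$ one has $\omega\in(\rho,\gamma)$ and $$|T(t,\tau)\eta-P_\Sigma(t)T(t,\tau)\eta|_{S(t)}\le|\eta-P_\Sigma(\tau)\eta|_{S(\tau)}e^{-\omega(t-\tau)}\quad\text{for } t\ge\tau,\ \eta\in X .$$ (IV) For each bounded $G\subset X$ there is $C_G>0$ with $\operatorname{dist}(T(t,\tau)G,\mathcal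 M(t))\le C_Ge^{-\omega(t-\tau)}$ for all $t\ge\tau$. If in addition $\omega>0$, then $\{\mathcal M(t)\}$ is an inertial manifold for $T$. -/

import Mathlib

open scoped ENNReal

noncomputable section

namespace InvMan

/-- An admissible norm on `ℝ²`: a definite seminorm which, on the closed first quadrant, is
monotone in each of its two arguments. -/
structure IsAdmissible (Γ : Seminorm ℝ (ℝ × ℝ)) : Prop where
  definite : ∀ x, Γ x = 0 → x = 0
  mono_snd : ∀ a : ℝ, 0 ≤ a → MonotoneOn (fun b : ℝ => Γ (a, b)) (Set.Ici 0)
  mono_fst : ∀ b : ℝ, 0 ≤ b → MonotoneOn (fun a : ℝ => Γ (a, b)) (Set.Ici 0)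

section Defs

variable {X : Type*} [NormedAddCommGroup X] [NormedSpace ℝ X]

/-- Linear evolution process `L(t,τ)`; only the values with `τ ≤ t` matter. -/
structure IsLinearEvolutionProcess (L : ℝ → ℝ → X →L[ℝ] X) : Prop where
  comp : ∀ t s τ : ℝ, τ ≤ s → s ≤ t → L t τ = (L t s).comp (L s τ)
  refl : ∀ t : ℝ, L t t = ContinuousLinearMap.id ℝ X
  cont : ∀ η : X, ContinuousOn (fun p : ℝ × ℝ => L p.1 p.2 η) {p | p.2 ≤ p.1}

/-- For `t ≤ τ` and `x ∈ Q(τ)X`, the backward operator `L(t,τ)x`: the point `y ∈ Q(t)X` with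
`L(τ,t) y = x` (unique when `L(τ,t)` is a bijection from `Q(t)X` onto `Q(τ)X`). -/
def backward (L : ℝ → ℝ → X →L[ℝ] X) (Q : ℝ → X →L[ℝ] X) (t τ : ℝ) (x : X) : X :=
  Function.invFunOn (L τ t) (Set.range (Q t)) x

/-- Exponential splitting with bound `M`, exponents `γ > ρ` and projections `Q(t)`. The
boundedness of the inverse `L(t,τ) : Q(τ)X → Q(t)X`, `t ≤ τ`, is part of `unstable`. -/
structure HasExponentialSplitting (L : ℝ → ℝ → X →L[ℝ] X) (Q : ℝ → X →L[ℝ] X)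
    (M γ ρ : ℝ) : Prop where
  one_le : 1 ≤ M
  exponents : ρ < γ
  proj : ∀ t : ℝ, (Q t).comp (Q t) = Q t
  commute : ∀ t τ : ℝ, τ ≤ t → (Q t).comp (L t τ) = (L t τ).comp (Q τ)
  bij : ∀ t τ : ℝ, τ ≤ t → Set.BijOn (L t τ) (Set.range (Q τ)) (Set.range (Q t))
  stable : ∀ t τ : ℝ, τ ≤ t →
    Real.exp (γ * (t - τ)) * ‖(L t τ).comp (ContinuousLinearMap.id ℝ X - Q τ)‖ ≤ M
  unstable : ∀ t τ : ℝ, t ≤ τ → ∀ x : X,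
    Real.exp (ρ * (t - τ)) * ‖backward L Q t τ (Q τ x)‖ ≤ M * ‖x‖

/-- The norm `|x|_{N(τ)} = sup_{t ≤ τ} e^{ρ(t-τ)} ‖L(t,τ)x‖`, for `x ∈ N(τ) = Q(τ)X`. -/
def normN (L : ℝ → ℝ → X →L[ℝ] X) (Q : ℝ → X →L[ℝ] X) (ρ τ : ℝ) (x : X) : ℝ :=
  ⨆ t : Set.Iic τ, Real.exp (ρ * ((t : ℝ) - τ)) * ‖backward L Q t τ x‖

/-- The norm `|x|_{S(τ)} = sup_{t ≥ τ} e^{γ(t-τ)} ‖L(t,τ)x‖`, for `x ∈ S(τ) = (I-Q(τ))X`. -/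
def normS (L : ℝ → ℝ → X →L[ℝ] X) (γ τ : ℝ) (x : X) : ℝ :=
  ⨆ t : Set.Ici τ, Real.exp (γ * ((t : ℝ) - τ)) * ‖L t τ x‖

/-- The adapted norm `‖x‖_τ = Γ(|Q(τ)x|_{N(τ)}, |(I-Q(τ))x|_{S(τ)})` on `X`. -/
def adaptedNorm (Γ : Seminorm ℝ (ℝ × ℝ)) (L : ℝ → ℝ → X →L[ℝ] X) (Q : ℝ → X →L[ℝ] X)
    (γ ρ τ : ℝ) (x : X) : ℝ :=
  Γ (normN L Q ρ τ (Q τ x), normS L γ τ (x - Q τ x))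

/-- (Nonlinear) evolution process `T(t,τ)`; only the values with `τ ≤ t` matter. -/
structure IsEvolutionProcess (T : ℝ → ℝ → X → X) : Prop where
  refl : ∀ (t : ℝ) (η : X), T t t η = η
  comp : ∀ t s τ : ℝ, τ ≤ s → s ≤ t → ∀ η : X, T t s (T s τ η) = T t τ η
  cont : ∀ (τ : ℝ) (η : X), ContinuousOn (fun t => T t τ η) (Set.Ici τ)

/-- Global solution (complete trajectory) of the process `T`. -/
def IsGlobalSolution (T : ℝ → ℝ → X → X) (z : ℝ → X) : Prop :=
  ∀ t τ : ℝ, τ ≤ t → T t τ (z τ) = z t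

/-- `sup_{r ≤ t} e^{σ r} ‖z(r)‖_r < ∞`. -/
def HasBackwardGrowth (Γ : Seminorm ℝ (ℝ × ℝ)) (L : ℝ → ℝ → X →L[ℝ] X) (Q : ℝ → X →L[ℝ] X)
    (γ ρ σ : ℝ) (z : ℝ → X) (t : ℝ) : Prop :=
  BddAbove ((fun r : ℝ => Real.exp (σ * r) * adaptedNorm Γ L Q γ ρ r (z r)) '' Set.Iic t)

/-- The set `M(t)` of all points `z(t)` on global solutions `z` with
`sup_{r ≤ t} e^{σ r} ‖z(r)‖_r < ∞`. -/
def manifoldM (Γ : Seminorm ℝ (ℝ × ℝ)) (L : ℝ → ℝ → X →L[ℝ] X) (Q : ℝ → X →L[ℝ] X)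
    (T : ℝ → ℝ → X → X) (γ ρ σ : ℝ) (t : ℝ) : Set X :=
  {η | ∃ z : ℝ → X, IsGlobalSolution T z ∧ z t = η ∧ HasBackwardGrowth Γ L Q γ ρ σ z t}

/-- Hausdorff semi-distance `sup_{a ∈ A} inf_{b ∈ B} ‖a - b‖`, with values in `[0,∞]`. -/
def semiDist (A B : Set X) : ℝ≥0∞ := ⨆ a ∈ A, Metric.infEDist a B

/-- `A` is the graph of a Lipschitz map from `PX` to `(I-P)X`. -/
def IsLipschitzGraph (P : X →L[ℝ] X) (A : Set X) : Prop :=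
  ∃ (φ : X → X) (K : NNReal), LipschitzOnWith K φ (Set.range P) ∧
    Set.MapsTo φ (Set.range P) (Set.range (ContinuousLinearMap.id ℝ X - P)) ∧
    A = (fun q => q + φ q) '' Set.range P

/-- Forward and pullback exponential domination with exponent `ω`. -/
def IsExpDominated (T : ℝ → ℝ → X → X) (A : ℝ → Set X) (ω : ℝ) : Prop :=
  ∀ U : Set X, Bornology.IsBounded U → ∃ s : ℝ, 0 ≤ s ∧ ∃ K : ℝ, 0 < K ∧
    ∀ t τ : ℝ, s ≤ t - τ →
      semiDist (T t τ '' U) (A t) ≤ ENNReal.ofReal (K * Real.exp (-ω * (t - τ)))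

/-- Invariance, exponential domination with exponent `ω`, and the Lipschitz graph property. -/
structure IsInvariantManifoldWith (Q : ℝ → X →L[ℝ] X) (T : ℝ → ℝ → X → X) (A : ℝ → Set X)
    (ω : ℝ) : Prop where
  invariant : ∀ t τ : ℝ, τ ≤ t → T t τ '' A τ = A t
  dominated : IsExpDominated T A ω
  graph : ∀ t : ℝ, IsLipschitzGraph (Q t) (A t)

/-- Invariant manifold of the process `T`, with graphs taken over the ranges of `Q(t)`. -/
def IsInvariantManifold (Q : ℝ → X →L[ℝ] X) (T : ℝ → ℝ → X → X) (A : ℝ → Set X) : Prop :=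
  ∃ ω : ℝ, IsInvariantManifoldWith Q T A ω

/-- Inertial manifold: an invariant manifold that is exponentially attracting (`ω > 0`). -/
def IsInertialManifold (Q : ℝ → X →L[ℝ] X) (T : ℝ → ℝ → X → X) (A : ℝ → Set X) : Prop :=
  ∃ ω : ℝ, 0 < ω ∧ IsInvariantManifoldWith Q T A ω

end Defs

/-- The positive solutions `k` of `γ - ρ = L₁ Γ(1,k) + L₂ Γ(1/k,1)`. -/
def kappaRoots (Γ : Seminorm ℝ (ℝ × ℝ)) (γ ρ L₁ L₂ : ℝ) : Set ℝ :=
  {k | 0 < k ∧ γ - ρ = L₁ * Γ (1, k) + L₂ * Γ (1 / k, 1)}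

end InvMan

end

open InvMan

/-! In the adapted norms the bound `M` disappears: a vector moves backward along the unstable
directions with rate `ρ`, and forward along the stable ones with rate `γ`, both with constant one.
Everything then reduces to scalar inequalities for the pair `(p, q)` of unstable and stable norms of
a difference of two solutions. The variation of constants formula bounds `p` backward from its
terminal value (`unstableNorm_mild_sub_le`) and `q` forward from its initial value
(`stableNorm_mild_sub_le`), and the coupling is through `Γ (p, q)`.

Existence. On curves growing backward at most like `e^{-σt}`, the Lyapunov–Perron operator contracts
the adapted norms with factor `Γ (L₁/(σ-ρ), L₂/(γ-σ))`, which the gap condition makes less than one.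
A fixed point is a backward solution with prescribed unstable part (`exists_mild_backward`), and `T`
extends it to a global solution.

Slope. The ansatz `p = P e^{-ν(t-τ)}`, `q = κ p` turns the two integral inequalities into equalities
when `ν = ρ + L₁ Γ (1, κ)` and `L₂ Γ (1, κ) = κ (γ - ν)`; eliminating `ν` gives the equation for
`κ`. The gap condition places its least root below a ratio `k₀`, which yields `ν < σ`.
`cone_estimate` shows that the ansatz dominates the difference of any two solutions of admissible
backward growth. Hence the manifold is a Lipschitz graph of slope `κ`, solutions on it are
determined by their unstable part, and they satisfy the backward bound with rate `ν`.

Attraction. A forward solution `u` is compared at each time `s` with the manifold solution `Z s`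
that has the same unstable part at time `s`. By the cone estimate between `Z r` and `Z s`, the
distance `m r` of `u r` to the graph controls `u - Z s` at time `r` up to `κ p`
(`stableNorm_sub_le_of_majorant`). What remains is a Gronwall inequality for `m` with constant `(L₂
+ κ L₁) Γ (0, 1)`, solved in `stableNorm_sub_le_exp`.

The time dependence of the adapted norms need not be continuous or measurable, so these norms are
never integrated. Each Gronwall step instead improves an explicit continuous majorant repeatedly,
through `le_of_contracting`. -/

namespace InvMan

open Set Filter Topology MeasureTheory

/-! ### Linear theory: backward operators, adapted norms, strong continuity -/

section Linear

variable {X : Type*} [NormedAddCommGroup X] [NormedSpace ℝ X]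
  {L : ℝ → ℝ → X →L[ℝ] X} {Q : ℝ → X →L[ℝ] X} {M γ ρ : ℝ}

open Classical in
/-- The operator `L(t,s)Q(s)` for `t ≤ s`, as a continuous linear map. -/
noncomputable def unstableBack (L : ℝ → ℝ → X →L[ℝ] X) (Q : ℝ → X →L[ℝ] X) (t s : ℝ) : X →L[ℝ] X :=
  if h : ∃ A : X →L[ℝ] X, ∀ x, A x = backward L Q t s (Q s x) then h.choose else 0

/-- The norm of the unstable component `|Q(τ)x|_{N(τ)}`. -/
noncomputable def unstableNorm (L : ℝ → ℝ → X →L[ℝ] X) (Q : ℝ → X →L[ℝ] X) (ρ τ : ℝ) (x : X) : ℝ :=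
  normN L Q ρ τ (Q τ x)

/-- The norm of the stable component `|(I-Q(τ))x|_{S(τ)}`. -/
noncomputable def stableNorm (L : ℝ → ℝ → X →L[ℝ] X) (Q : ℝ → X →L[ℝ] X) (γ τ : ℝ) (x : X) : ℝ :=
  normS L γ τ (x - Q τ x)

lemma adaptedNorm_eq (Γ : Seminorm ℝ (ℝ × ℝ)) (τ : ℝ) (x : X) :
    adaptedNorm Γ L Q γ ρ τ x = Γ (unstableNorm L Q ρ τ x, stableNorm L Q γ τ x) := rfl

lemma evolution_comp (hL : IsLinearEvolutionProcess L) {t s r : ℝ} (h₁ : r ≤ s) (h₂ : s ≤ t)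
    (x : X) : L t s (L s r x) = L t r x := by
  rw [hL.comp t s r h₁ h₂]; rfl

lemma evolution_refl (hL : IsLinearEvolutionProcess L) (t : ℝ) (x : X) : L t t x = x := by
  rw [hL.refl t]; rfl

lemma proj_proj (hQ : HasExponentialSplitting L Q M γ ρ) (t : ℝ) (x : X) :
    Q t (Q t x) = Q t x :=
  DFunLike.congr_fun (hQ.proj t) x

lemma proj_evolution (hQ : HasExponentialSplitting L Q M γ ρ) {t s : ℝ} (h : s ≤ t) (x : X) :
    Q t (L t s x) = L t s (Q s x) :=
  DFunLike.congr_fun (hQ.commute t s h) x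

lemma backward_spec (hQ : HasExponentialSplitting L Q M γ ρ) {t s : ℝ} (h : t ≤ s) (x : X) :
    backward L Q t s (Q s x) ∈ range (Q t) ∧ L s t (backward L Q t s (Q s x)) = Q s x := by
  have hs : ∃ a ∈ range (Q t), L s t a = Q s x := (hQ.bij s t h).surjOn ⟨x, rfl⟩
  exact ⟨Function.invFunOn_mem hs, Function.invFunOn_eq hs⟩

lemma backward_unique (hQ : HasExponentialSplitting L Q M γ ρ) {t s : ℝ} (h : t ≤ s) {x y : X}
    (hy : y ∈ range (Q t)) (hxy : L s t y = Q s x) : backward L Q t s (Q s x) = y :=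
  (hQ.bij s t h).injOn (backward_spec hQ h x).1 hy ((backward_spec hQ h x).2.trans hxy.symm)

/-- The pointwise inverse is linear because preimages inside the range of `Q t` are unique, and
bounded by the unstable estimate of the splitting. So the conditional definition never takes its
default value for `t ≤ s`. -/
lemma unstableBack_apply (hQ : HasExponentialSplitting L Q M γ ρ) {t s : ℝ} (h : t ≤ s) (x : X) :
    unstableBack L Q t s x = backward L Q t s (Q s x) := by
  have hex : ∃ A : X →L[ℝ] X, ∀ x, A x = backward L Q t s (Q s x) := by
    refine ⟨LinearMap.mkContinuous
      { toFun := fun x => backward L Q t s (Q s x)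
        map_add' := fun x y => ?_
        map_smul' := fun c x => ?_ } (M / Real.exp (ρ * (t - s))) fun x => ?_, fun x => rfl⟩
    · obtain ⟨⟨a, ha⟩, hx⟩ := backward_spec hQ h x
      obtain ⟨⟨b, hb⟩, hy⟩ := backward_spec hQ h y
      exact backward_unique hQ h ⟨a + b, by rw [map_add, ha, hb]⟩ (by rw [map_add, map_add, hx, hy])
    · obtain ⟨⟨a, ha⟩, hx⟩ := backward_spec hQ h x
      exact backward_unique hQ h ⟨c • a, by rw [map_smul, ha]; rfl⟩
        (by rw [map_smul, RingHom.id_apply, map_smul, hx])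
    · have := hQ.unstable t s h x
      rw [div_mul_eq_mul_div, le_div_iff₀ (Real.exp_pos _), mul_comm]
      exact this
  rw [unstableBack, dif_pos hex]
  exact hex.choose_spec x

lemma proj_unstableBack (hQ : HasExponentialSplitting L Q M γ ρ) {t s : ℝ} (h : t ≤ s) (x : X) :
    Q t (unstableBack L Q t s x) = unstableBack L Q t s x := by
  rw [unstableBack_apply hQ h]
  obtain ⟨⟨a, ha⟩, -⟩ := backward_spec hQ h x
  rw [← ha, proj_proj hQ]

lemma evolution_unstableBack_self (hQ : HasExponentialSplitting L Q M γ ρ) {t s : ℝ} (h : t ≤ s)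
    (x : X) : L s t (unstableBack L Q t s x) = Q s x := by
  rw [unstableBack_apply hQ h]
  exact (backward_spec hQ h x).2

lemma unstableBack_unique (hQ : HasExponentialSplitting L Q M γ ρ) {t s : ℝ} (h : t ≤ s) {x y : X}
    (hy : Q t y = y) (hxy : L s t y = Q s x) : unstableBack L Q t s x = y := by
  rw [unstableBack_apply hQ h]
  exact backward_unique hQ h ⟨y, hy⟩ hxy

lemma unstableBack_evolution (hL : IsLinearEvolutionProcess L)
    (hQ : HasExponentialSplitting L Q M γ ρ) {t r s : ℝ} (h₁ : t ≤ r) (h₂ : r ≤ s) (x : X) :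
    unstableBack L Q t s (L s r x) = unstableBack L Q t r x :=
  unstableBack_unique hQ (h₁.trans h₂) (proj_unstableBack hQ h₁ x) (by
    rw [← evolution_comp hL h₁ h₂, evolution_unstableBack_self hQ h₁, proj_evolution hQ h₂])

lemma unstableBack_self (hL : IsLinearEvolutionProcess L)
    (hQ : HasExponentialSplitting L Q M γ ρ) (t : ℝ) (x : X) :
    unstableBack L Q t t x = Q t x :=
  unstableBack_unique hQ le_rfl (proj_proj hQ t x) (evolution_refl hL t _)

lemma unstableBack_evolution_self (hL : IsLinearEvolutionProcess L)
    (hQ : HasExponentialSplitting L Q M γ ρ) {t s : ℝ} (h : t ≤ s) (x : X) :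
    unstableBack L Q t s (L s t x) = Q t x := by
  rw [unstableBack_evolution hL hQ le_rfl h, unstableBack_self hL hQ]

lemma evolution_unstableBack (hL : IsLinearEvolutionProcess L)
    (hQ : HasExponentialSplitting L Q M γ ρ) {r t s : ℝ} (h₁ : r ≤ t) (h₂ : t ≤ s) (x : X) :
    L t r (unstableBack L Q r s x) = unstableBack L Q t s x := by
  refine (unstableBack_unique hQ h₂ ?_ ?_).symm
  · rw [proj_evolution hQ h₁, proj_unstableBack hQ (h₁.trans h₂)]
  · rw [evolution_comp hL h₁ h₂, evolution_unstableBack_self hQ (h₁.trans h₂)]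

lemma unstableBack_comp (hL : IsLinearEvolutionProcess L)
    (hQ : HasExponentialSplitting L Q M γ ρ) {r t s : ℝ} (h₁ : r ≤ t) (h₂ : t ≤ s) (x : X) :
    unstableBack L Q r t (unstableBack L Q t s x) = unstableBack L Q r s x := by
  rw [← evolution_unstableBack hL hQ h₁ h₂, unstableBack_evolution_self hL hQ h₁,
    proj_unstableBack hQ (h₁.trans h₂)]

lemma unstableBack_proj (hQ : HasExponentialSplitting L Q M γ ρ) {t s : ℝ} (h : t ≤ s) (x : X) :
    unstableBack L Q t s (Q s x) = unstableBack L Q t s x := by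
  rw [unstableBack_apply hQ h, unstableBack_apply hQ h, proj_proj hQ]

lemma exp_mul_norm_unstableBack_le (hQ : HasExponentialSplitting L Q M γ ρ) {t s : ℝ}
    (h : t ≤ s) (x : X) : Real.exp (ρ * (t - s)) * ‖unstableBack L Q t s x‖ ≤ M * ‖x‖ := by
  rw [unstableBack_apply hQ h]
  exact hQ.unstable t s h x

lemma norm_proj_le (hL : IsLinearEvolutionProcess L) (hQ : HasExponentialSplitting L Q M γ ρ)
    (t : ℝ) (x : X) : ‖Q t x‖ ≤ M * ‖x‖ := by
  simpa [unstableBack_self hL hQ] using exp_mul_norm_unstableBack_le hQ (le_refl t) x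

lemma exp_mul_norm_stable_le (hQ : HasExponentialSplitting L Q M γ ρ) {t s : ℝ} (h : s ≤ t)
    (x : X) : Real.exp (γ * (t - s)) * ‖L t s (x - Q s x)‖ ≤ M * ‖x‖ := by
  have h₁ := ((L t s).comp (ContinuousLinearMap.id ℝ X - Q s)).le_opNorm x
  have h₂ := hQ.stable t s h
  calc Real.exp (γ * (t - s)) * ‖L t s (x - Q s x)‖
      ≤ Real.exp (γ * (t - s)) *
        (‖(L t s).comp (ContinuousLinearMap.id ℝ X - Q s)‖ * ‖x‖) := by gcongr; exact h₁
    _ ≤ M * ‖x‖ := by rw [← mul_assoc]; gcongr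

lemma zero_le_bound (hQ : HasExponentialSplitting L Q M γ ρ) : 0 ≤ M := zero_le_one.trans hQ.one_le

/-! ### The component norms -/

lemma bddAbove_unstable (hQ : HasExponentialSplitting L Q M γ ρ) (τ : ℝ) (x : X) :
    BddAbove (range fun t : Iic τ =>
      Real.exp (ρ * ((t : ℝ) - τ)) * ‖backward L Q t τ (Q τ x)‖) := by
  refine ⟨M * ‖x‖, ?_⟩
  rintro _ ⟨t, rfl⟩
  exact hQ.unstable t τ t.2 x

lemma exp_mul_norm_le_unstableNorm (hQ : HasExponentialSplitting L Q M γ ρ) {t τ : ℝ}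
    (h : t ≤ τ) (x : X) :
    Real.exp (ρ * (t - τ)) * ‖unstableBack L Q t τ x‖ ≤ unstableNorm L Q ρ τ x := by
  rw [unstableBack_apply hQ h]
  exact le_ciSup (bddAbove_unstable hQ τ x) (⟨t, h⟩ : Iic τ)

lemma norm_unstableBack_le (hQ : HasExponentialSplitting L Q M γ ρ) {t τ : ℝ}
    (h : t ≤ τ) (x : X) :
    ‖unstableBack L Q t τ x‖ ≤ Real.exp (-ρ * (t - τ)) * unstableNorm L Q ρ τ x := by
  rw [neg_mul, Real.exp_neg, ← div_eq_inv_mul, le_div_iff₀ (Real.exp_pos _), mul_comm]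
  exact exp_mul_norm_le_unstableNorm hQ h x

lemma unstableNorm_le (hQ : HasExponentialSplitting L Q M γ ρ) {τ c : ℝ} {x : X}
    (h : ∀ t ≤ τ, ‖unstableBack L Q t τ x‖ ≤ Real.exp (-ρ * (t - τ)) * c) :
    unstableNorm L Q ρ τ x ≤ c := by
  have : Nonempty (Iic τ) := ⟨⟨τ, self_mem_Iic⟩⟩
  refine ciSup_le fun t => ?_
  have := h t t.2
  rw [neg_mul, Real.exp_neg, ← div_eq_inv_mul, le_div_iff₀ (Real.exp_pos _), mul_comm] at this
  rwa [← unstableBack_apply hQ t.2]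

lemma bddAbove_stable (hQ : HasExponentialSplitting L Q M γ ρ) (τ : ℝ) (x : X) :
    BddAbove (range fun t : Ici τ =>
      Real.exp (γ * ((t : ℝ) - τ)) * ‖L t τ (x - Q τ x)‖) := by
  refine ⟨M * ‖x‖, ?_⟩
  rintro _ ⟨t, rfl⟩
  exact exp_mul_norm_stable_le hQ t.2 x

lemma norm_stable_le (hQ : HasExponentialSplitting L Q M γ ρ) {t τ : ℝ}
    (h : τ ≤ t) (x : X) :
    ‖L t τ (x - Q τ x)‖ ≤ Real.exp (-γ * (t - τ)) * stableNorm L Q γ τ x := by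
  rw [neg_mul, Real.exp_neg, ← div_eq_inv_mul, le_div_iff₀ (Real.exp_pos _), mul_comm]
  exact le_ciSup (bddAbove_stable hQ τ x) (⟨t, h⟩ : Ici τ)

lemma stableNorm_le {τ c : ℝ} {x : X}
    (h : ∀ t, τ ≤ t → ‖L t τ (x - Q τ x)‖ ≤ Real.exp (-γ * (t - τ)) * c) :
    stableNorm L Q γ τ x ≤ c := by
  have : Nonempty (Ici τ) := ⟨⟨τ, self_mem_Ici⟩⟩
  refine ciSup_le fun t => ?_
  have := h t t.2
  rwa [neg_mul, Real.exp_neg, ← div_eq_inv_mul, le_div_iff₀ (Real.exp_pos _), mul_comm] at this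

lemma unstableNorm_nonneg (τ : ℝ) (x : X) : 0 ≤ unstableNorm L Q ρ τ x :=
  Real.iSup_nonneg fun _ => by positivity

lemma stableNorm_nonneg (τ : ℝ) (x : X) : 0 ≤ stableNorm L Q γ τ x :=
  Real.iSup_nonneg fun _ => by positivity

lemma unstableNorm_le_norm (hQ : HasExponentialSplitting L Q M γ ρ) (τ : ℝ) (x : X) :
    unstableNorm L Q ρ τ x ≤ M * ‖x‖ := by
  refine unstableNorm_le hQ fun t ht => ?_
  rw [neg_mul, Real.exp_neg, ← div_eq_inv_mul, le_div_iff₀ (Real.exp_pos _), mul_comm]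
  exact exp_mul_norm_unstableBack_le hQ ht x

lemma stableNorm_le_norm (hQ : HasExponentialSplitting L Q M γ ρ) (τ : ℝ) (x : X) :
    stableNorm L Q γ τ x ≤ M * ‖x‖ := by
  refine stableNorm_le fun t ht => ?_
  rw [neg_mul, Real.exp_neg, ← div_eq_inv_mul, le_div_iff₀ (Real.exp_pos _), mul_comm]
  exact exp_mul_norm_stable_le hQ ht x

lemma norm_proj_le_unstableNorm (hL : IsLinearEvolutionProcess L)
    (hQ : HasExponentialSplitting L Q M γ ρ) (τ : ℝ) (x : X) :
    ‖Q τ x‖ ≤ unstableNorm L Q ρ τ x := by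
  simpa [unstableBack_self hL hQ] using norm_unstableBack_le hQ (le_refl τ) x

lemma norm_sub_proj_le_stableNorm (hL : IsLinearEvolutionProcess L)
    (hQ : HasExponentialSplitting L Q M γ ρ) (τ : ℝ) (x : X) :
    ‖x - Q τ x‖ ≤ stableNorm L Q γ τ x := by
  simpa [hL.refl] using norm_stable_le hQ (le_refl τ) x

lemma norm_le_add (hL : IsLinearEvolutionProcess L)
    (hQ : HasExponentialSplitting L Q M γ ρ) (τ : ℝ) (x : X) :
    ‖x‖ ≤ unstableNorm L Q ρ τ x + stableNorm L Q γ τ x := by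
  calc ‖x‖ = ‖Q τ x + (x - Q τ x)‖ := by congr 1; abel
    _ ≤ _ := (norm_add_le _ _).trans
      (add_le_add (norm_proj_le_unstableNorm hL hQ τ x) (norm_sub_proj_le_stableNorm hL hQ τ x))

lemma unstableNorm_add_le (hQ : HasExponentialSplitting L Q M γ ρ) (τ : ℝ) (x y : X) :
    unstableNorm L Q ρ τ (x + y) ≤ unstableNorm L Q ρ τ x + unstableNorm L Q ρ τ y := by
  refine unstableNorm_le hQ fun t ht => ?_
  rw [map_add, mul_add]
  exact (norm_add_le _ _).trans (add_le_add (norm_unstableBack_le hQ ht x)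
    (norm_unstableBack_le hQ ht y))

lemma stableNorm_add_le (hQ : HasExponentialSplitting L Q M γ ρ) (τ : ℝ) (x y : X) :
    stableNorm L Q γ τ (x + y) ≤ stableNorm L Q γ τ x + stableNorm L Q γ τ y := by
  refine stableNorm_le fun t ht => ?_
  rw [map_add, mul_add, add_sub_add_comm, map_add]
  exact (norm_add_le _ _).trans (add_le_add (norm_stable_le hQ ht x) (norm_stable_le hQ ht y))

lemma unstableNorm_neg (hQ : HasExponentialSplitting L Q M γ ρ) (τ : ℝ) (x : X) :
    unstableNorm L Q ρ τ (-x) = unstableNorm L Q ρ τ x := by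
  have h (y : X) : unstableNorm L Q ρ τ (-y) ≤ unstableNorm L Q ρ τ y :=
    unstableNorm_le hQ fun t ht => by
      rw [map_neg, norm_neg]; exact norm_unstableBack_le hQ ht y
  exact le_antisymm (h x) (by simpa using h (-x))

lemma stableNorm_neg (τ : ℝ) (x : X) :
    stableNorm L Q γ τ (-x) = stableNorm L Q γ τ x := by
  unfold stableNorm normS
  congr 1
  ext t
  rw [map_neg, ← neg_sub', map_neg, norm_neg]

lemma unstableNorm_proj (hQ : HasExponentialSplitting L Q M γ ρ) (τ : ℝ) (x : X) :
    unstableNorm L Q ρ τ (Q τ x) = unstableNorm L Q ρ τ x := by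
  rw [unstableNorm, proj_proj hQ, unstableNorm]

lemma unstableNorm_congr {τ : ℝ} {x y : X} (h : Q τ x = Q τ y) :
    unstableNorm L Q ρ τ x = unstableNorm L Q ρ τ y := by
  rw [unstableNorm, h, unstableNorm]

lemma stableNorm_congr {τ : ℝ} {x y : X} (h : x - Q τ x = y - Q τ y) :
    stableNorm L Q γ τ x = stableNorm L Q γ τ y := by
  rw [stableNorm, h, stableNorm]

lemma unstableNorm_unstableBack_le (hL : IsLinearEvolutionProcess L)
    (hQ : HasExponentialSplitting L Q M γ ρ) {t s : ℝ} (h : t ≤ s) (x : X) :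
    unstableNorm L Q ρ t (unstableBack L Q t s x) ≤
      Real.exp (-ρ * (t - s)) * unstableNorm L Q ρ s x := by
  refine unstableNorm_le hQ fun r hr => ?_
  rw [unstableBack_comp hL hQ hr h, ← mul_assoc, ← Real.exp_add]
  convert norm_unstableBack_le hQ (hr.trans h) x using 3
  ring

lemma stableNorm_evolution_le (hL : IsLinearEvolutionProcess L)
    (hQ : HasExponentialSplitting L Q M γ ρ) {t s : ℝ} (h : s ≤ t) (x : X) :
    stableNorm L Q γ t (L t s x) ≤ Real.exp (-γ * (t - s)) * stableNorm L Q γ s x := by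
  refine stableNorm_le fun r hr => ?_
  rw [proj_evolution hQ h, ← map_sub, evolution_comp hL h hr, ← mul_assoc, ← Real.exp_add]
  convert norm_stable_le hQ (h.trans hr) x using 3
  ring

/-! ### Continuity -/

/-- A strongly continuous, locally bounded family of operators applied to a continuous function. -/
lemma continuousOn_clm_apply {α : Type*} [TopologicalSpace α] {A : α → X →L[ℝ] X} {v : α → X}
    {s : Set α} (hA : ∀ x, ContinuousOn (fun a => A a x) s)
    (hb : ∀ a ∈ s, ∃ B, ∀ᶠ a' in 𝓝[s] a, ‖A a'‖ ≤ B) (hv : ContinuousOn v s) :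
    ContinuousOn (fun a => A a (v a)) s := by
  intro a ha
  obtain ⟨B, hB⟩ := hb a ha
  have h₁ : Tendsto (fun a' => A a' (v a' - v a)) (𝓝[s] a) (𝓝 0) := by
    have h0 : Tendsto (fun a' => |B| * ‖v a' - v a‖) (𝓝[s] a) (𝓝 0) := by
      have := (hv a ha).sub_const (v a)
      simpa using (this.norm.const_mul |B|)
    refine squeeze_zero_norm' ?_ h0
    filter_upwards [hB] with a' ha'
    exact ((A a').le_opNorm _).trans (by gcongr; exact ha'.trans (le_abs_self B))
  have h₂ : Tendsto (fun a' => A a' (v a)) (𝓝[s] a) (𝓝 (A a (v a))) := hA (v a) a ha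
  have h₃ := h₁.add h₂
  rw [zero_add] at h₃
  refine h₃.congr fun a' => ?_
  rw [← map_add, sub_add_cancel]

/-- Strong continuity bounds each orbit on the compact triangle; Banach–Steinhaus makes the bound
uniform. -/
lemma exists_bound_evolution [CompleteSpace X] (hL : IsLinearEvolutionProcess L) (a b : ℝ) :
    ∃ B, 0 ≤ B ∧ ∀ s t, a ≤ s → s ≤ t → t ≤ b → ‖L t s‖ ≤ B := by
  let K : Set (ℝ × ℝ) := (Icc a b ×ˢ Icc a b) ∩ {p | p.2 ≤ p.1}
  have hK : IsCompact K := (isCompact_Icc.prod isCompact_Icc).inter_right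
    (isClosed_le continuous_snd continuous_fst)
  obtain ⟨C, hC⟩ := banach_steinhaus (g := fun p : K => L p.1.1 p.1.2) (fun x => by
    obtain ⟨C, hC⟩ := hK.exists_bound_of_continuousOn ((hL.cont x).mono inter_subset_right)
    exact ⟨C, fun p => hC p.1 p.2⟩)
  refine ⟨|C|, abs_nonneg C, fun s t h₁ h₂ h₃ => ?_⟩
  exact (hC ⟨(t, s), ⟨⟨h₁.trans h₂, h₃⟩, ⟨h₁, h₂.trans h₃⟩⟩, h₂⟩).trans (le_abs_self C)

lemma continuousOn_evolution [CompleteSpace X] (hL : IsLinearEvolutionProcess L)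
    {α : Type*} [TopologicalSpace α] {S : Set α} {t s : α → ℝ} {v : α → X}
    (ht : ContinuousOn t S) (hs : ContinuousOn s S) (hv : ContinuousOn v S)
    (hst : ∀ a ∈ S, s a ≤ t a) : ContinuousOn (fun a => L (t a) (s a) (v a)) S := by
  refine continuousOn_clm_apply (A := fun a => L (t a) (s a)) (fun x => ?_) (fun a ha => ?_) hv
  · exact (hL.cont x).comp (ht.prodMk hs) hst
  · obtain ⟨B, -, hB⟩ := exists_bound_evolution hL (s a - 1) (t a + 1)
    refine ⟨B, ?_⟩
    filter_upwards [(hs a ha).eventually (lt_mem_nhds (sub_one_lt (s a))),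
      (ht a ha).eventually (gt_mem_nhds (lt_add_one (t a))), self_mem_nhdsWithin] with b h₁ h₂ h₃
    exact hB _ _ h₁.le (hst b h₃) h₂.le

lemma opNorm_proj_le (hL : IsLinearEvolutionProcess L)
    (hQ : HasExponentialSplitting L Q M γ ρ) (t : ℝ) : ‖Q t‖ ≤ M :=
  (Q t).opNorm_le_bound (zero_le_bound hQ) (norm_proj_le hL hQ t)

/-- Continuity of the projections is not part of the splitting; it follows from commutation with
`L`. From the right, `Q t` acts on `L t t₀ x`, which tends to `x`. From the left, the unstable and
stable parts of `x` need separate arguments, since `L` does not run backward on the stable part. -/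
lemma continuous_proj_apply (hL : IsLinearEvolutionProcess L)
    (hQ : HasExponentialSplitting L Q M γ ρ) (x : X) : Continuous fun t => Q t x := by
  rw [continuous_iff_continuousAt]
  intro t₀
  have hM := zero_le_bound hQ
  -- an operator-norm bound reduces convergence of `Q t x` to convergence along moving arguments
  have key : ∀ (l : Filter ℝ) (y : ℝ → X) (x z : X), Tendsto y l (𝓝 x) →
      Tendsto (fun t => Q t (y t)) l (𝓝 z) → Tendsto (fun t => Q t x) l (𝓝 z) := by
    intro l y x z hy hz
    have h₁ : Tendsto (fun t => Q t (x - y t)) l (𝓝 0) := by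
      refine squeeze_zero_norm (fun t => norm_proj_le hL hQ t _) ?_
      simpa using ((hy.const_sub x).norm.const_mul M)
    have h₂ := h₁.add hz
    rw [zero_add] at h₂
    refine h₂.congr fun t => ?_
    rw [← map_add, sub_add_cancel]
  have hright : Tendsto (fun t => Q t x) (𝓝[≥] t₀) (𝓝 (Q t₀ x)) := by
    have hc : ∀ y, Tendsto (fun t => L t t₀ y) (𝓝[≥] t₀) (𝓝 y) := fun y => by
      have := ((hL.cont y).comp (f := fun t : ℝ => (t, t₀)) (s := Ici t₀) (by fun_prop)
        (fun t ht => ht)) t₀ self_mem_Ici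
      simpa [ContinuousWithinAt, Function.comp_def, hL.refl] using this
    refine key _ (fun t => L t t₀ x) x _ (hc x) ((hc (Q t₀ x)).congr' ?_)
    filter_upwards [self_mem_nhdsWithin] with t ht
    rw [proj_evolution hQ ht]
  have hleft : Tendsto (fun t => Q t x) (𝓝[≤] t₀) (𝓝 (Q t₀ x)) := by
    -- The unstable part is pulled back to time `t₀ - 1` and then follows a forward orbit on which
    -- `Q t` acts as the identity.
    have hN : Tendsto (fun t => Q t (Q t₀ x)) (𝓝[≤] t₀) (𝓝 (Q t₀ x)) := by
      set y := unstableBack L Q (t₀ - 1) t₀ x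
      have hc : Tendsto (fun t => L t (t₀ - 1) y) (𝓝[≤] t₀) (𝓝 (Q t₀ x)) := by
        have := ((hL.cont y).comp (f := fun t : ℝ => (t, t₀ - 1)) (s := Ici (t₀ - 1))
          (by fun_prop) (fun t ht => ht)).continuousAt (Ici_mem_nhds (sub_one_lt t₀))
        have h := this.tendsto
        simp only [Function.comp_def] at h
        rw [evolution_unstableBack_self hQ (sub_one_lt t₀).le] at h
        exact h.mono_left nhdsWithin_le_nhds
      refine key _ _ _ _ hc (hc.congr' ?_)
      filter_upwards [mem_nhdsWithin_of_mem_nhds (Ici_mem_nhds (sub_one_lt t₀))] with t ht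
      rw [proj_evolution hQ ht, proj_unstableBack hQ (sub_one_lt t₀).le]
    have hS : Tendsto (fun t => Q t (x - Q t₀ x)) (𝓝[≤] t₀) (𝓝 0) := by
      set v := x - Q t₀ x
      have hv : Q t₀ v = 0 := by simp [v, proj_proj hQ]
      have hc : Tendsto (fun t => L t₀ t v) (𝓝[≤] t₀) (𝓝 v) := by
        have := ((hL.cont v).comp (f := fun t : ℝ => (t₀, t)) (s := Iic t₀) (by fun_prop)
          (fun t ht => ht)) t₀ self_mem_Iic
        simpa [ContinuousWithinAt, Function.comp_def, hL.refl] using this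
      have hb : Tendsto (fun t => Real.exp (-ρ * (t - t₀)) * (M * ‖Q t₀ (L t₀ t v)‖)) (𝓝[≤] t₀)
          (𝓝 0) := by
        have h₁ := (((Q t₀).continuous.tendsto v).comp hc).norm.const_mul M
        have h₂ : Tendsto (fun t => Real.exp (-ρ * (t - t₀))) (𝓝[≤] t₀)
            (𝓝 (Real.exp (-ρ * (t₀ - t₀)))) :=
          ((by fun_prop : Continuous fun t => Real.exp (-ρ * (t - t₀))).tendsto t₀).mono_left
            nhdsWithin_le_nhds
        simpa [hv] using h₂.mul h₁
      refine squeeze_zero_norm' ?_ hb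
      filter_upwards [self_mem_nhdsWithin] with t (ht : t ≤ t₀)
      -- `Q t v` is the backward image of `Q t₀ (L t₀ t v)`, which tends to `Q t₀ v = 0`.
      rw [← unstableBack_evolution_self hL hQ ht, ← unstableBack_proj hQ ht]
      refine (norm_unstableBack_le hQ ht _).trans ?_
      gcongr
      exact unstableNorm_le_norm hQ _ _
    have := hN.add hS
    rw [add_zero] at this
    refine this.congr fun t => ?_
    rw [← map_add, add_sub_cancel]
  rw [ContinuousAt, ← nhdsWithin_univ, ← Iic_union_Ici (a := t₀), nhdsWithin_union]
  exact hleft.sup hright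

lemma continuousOn_proj (hL : IsLinearEvolutionProcess L)
    (hQ : HasExponentialSplitting L Q M γ ρ) {α : Type*} [TopologicalSpace α] {S : Set α}
    {t : α → ℝ} {v : α → X} (ht : ContinuousOn t S) (hv : ContinuousOn v S) :
    ContinuousOn (fun a => Q (t a) (v a)) S :=
  continuousOn_clm_apply (A := fun a => Q (t a))
    (fun x => (continuous_proj_apply hL hQ x).comp_continuousOn ht)
    (fun _ _ => ⟨M, Eventually.of_forall fun a' => opNorm_proj_le hL hQ (t a')⟩) hv

lemma continuousOn_unstableBack (hL : IsLinearEvolutionProcess L)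
    (hQ : HasExponentialSplitting L Q M γ ρ) {τ : ℝ} {v : ℝ → X} (hv : ContinuousOn v (Iic τ)) :
    ContinuousOn (fun t => unstableBack L Q t τ (v t)) (Iic τ) := by
  refine continuousOn_clm_apply (A := fun t => unstableBack L Q t τ) (fun x => ?_)
    (fun a ha => ?_) hv
  · intro t ht
    -- Near `t` the backward orbit is the forward orbit of its own value at `t - 1`, so forward
    -- continuity suffices.
    set y := unstableBack L Q (t - 1) τ x
    have h₁ : t - 1 < t := sub_one_lt t
    have := ((hL.cont y).comp (f := fun r : ℝ => (r, t - 1)) (s := Ici (t - 1))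
          (by fun_prop) (fun r hr => hr)).continuousAt (Ici_mem_nhds h₁)
    refine (this.continuousWithinAt (s := Iic τ)).congr_of_eventuallyEq ?_ ?_
    · filter_upwards [mem_nhdsWithin_of_mem_nhds (Ici_mem_nhds h₁), self_mem_nhdsWithin]
        with r hr hr'
      exact (evolution_unstableBack hL hQ hr hr' x).symm
    · exact (evolution_unstableBack hL hQ h₁.le ht x).symm
  · refine ⟨Real.exp (|ρ| * (τ - (a - 1))) * M, ?_⟩
    filter_upwards [mem_nhdsWithin_of_mem_nhds (Ici_mem_nhds (sub_one_lt a)),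
      self_mem_nhdsWithin] with t (ht : a - 1 ≤ t) (ht' : t ≤ τ)
    have hM := zero_le_bound hQ
    refine ContinuousLinearMap.opNorm_le_bound _ (by positivity) fun x => ?_
    refine (norm_unstableBack_le hQ ht' x).trans ?_
    rw [mul_assoc]
    refine mul_le_mul ?_ (unstableNorm_le_norm hQ _ _) (unstableNorm_nonneg _ _) (Real.exp_pos _).le
    · apply Real.exp_le_exp.2
      calc -ρ * (t - τ) = ρ * (τ - t) := by ring
        _ ≤ |ρ| * (τ - t) := by
          have : 0 ≤ τ - t := by linarith
          gcongr
          exact le_abs_self ρ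
        _ ≤ |ρ| * (τ - (a - 1)) := by gcongr

/-! ### Integral estimates -/

lemma continuousOn_integrand [CompleteSpace X] (hL : IsLinearEvolutionProcess L) {g : ℝ → X}
    {a b : ℝ} (hg : ContinuousOn g (Icc a b)) : ContinuousOn (fun s => L b s (g s)) (Icc a b) :=
  continuousOn_evolution hL continuousOn_const continuousOn_id hg fun _ h => h.2

lemma intervalIntegrable_integrand [CompleteSpace X] (hL : IsLinearEvolutionProcess L) {g : ℝ → X}
    {a b : ℝ} (hab : a ≤ b) (hg : ContinuousOn g (Icc a b)) :
    IntervalIntegrable (fun s => L b s (g s)) volume a b :=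
  ContinuousOn.intervalIntegrable (by rw [uIcc_of_le hab]; exact continuousOn_integrand hL hg)

/-- The backward operator passes under the integral and collapses by the cocycle law, and the
weights `e^{-ρ(r-t)}` and `e^{-ρ(t-s)}` multiply to `e^{-ρ(r-s)}`. Hence no factor `M` appears. The
continuous majorant `ψ` avoids any measurability question for the adapted norms. -/
lemma unstableNorm_integral_le [CompleteSpace X] (hL : IsLinearEvolutionProcess L)
    (hQ : HasExponentialSplitting L Q M γ ρ) {g : ℝ → X} {ψ : ℝ → ℝ} {t τ : ℝ} (h : t ≤ τ)
    (hg : ContinuousOn g (Icc t τ)) (hψ : ContinuousOn ψ (Icc t τ))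
    (hgψ : ∀ s ∈ Icc t τ, unstableNorm L Q ρ s (g s) ≤ ψ s) :
    unstableNorm L Q ρ t (unstableBack L Q t τ (∫ s in t..τ, L τ s (g s))) ≤
      ∫ s in t..τ, Real.exp (-ρ * (t - s)) * ψ s := by
  refine unstableNorm_le hQ fun r hr => ?_
  rw [unstableBack_comp hL hQ hr h, ← ContinuousLinearMap.intervalIntegral_comp_comm _
    (intervalIntegrable_integrand hL h hg), ← intervalIntegral.integral_const_mul]
  refine intervalIntegral.norm_integral_le_of_norm_le h (Eventually.of_forall fun s hs => ?_) ?_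
  · have hs' : s ∈ Icc t τ := ⟨hs.1.le, hs.2⟩
    rw [unstableBack_evolution hL hQ (hr.trans hs'.1) hs'.2]
    refine (norm_unstableBack_le hQ (hr.trans hs'.1) _).trans ?_
    rw [← mul_assoc, ← Real.exp_add]
    rw [show -ρ * (r - t) + -ρ * (t - s) = -ρ * (r - s) by ring]
    exact mul_le_mul_of_nonneg_left (hgψ s hs') (Real.exp_pos _).le
  · apply ContinuousOn.intervalIntegrable
    rw [uIcc_of_le h]
    fun_prop

/-- The forward counterpart, over a general measurable set so that it serves both bounded intervals
and the half-line of the Lyapunov–Perron operator. -/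
lemma stableNorm_integral_le [CompleteSpace X] (hL : IsLinearEvolutionProcess L)
    (hQ : HasExponentialSplitting L Q M γ ρ) {g : ℝ → X} {ψ : ℝ → ℝ} {t : ℝ} {A : Set ℝ}
    (hA : MeasurableSet A) (hAt : A ⊆ Iic t)
    (hg : IntegrableOn (fun s => L t s (g s) - Q t (L t s (g s))) A)
    (hψ : IntegrableOn (fun s => Real.exp (-γ * (t - s)) * ψ s) A)
    (hgψ : ∀ s ∈ A, stableNorm L Q γ s (g s) ≤ ψ s) :
    stableNorm L Q γ t (∫ s in A, (L t s (g s) - Q t (L t s (g s)))) ≤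
      ∫ s in A, Real.exp (-γ * (t - s)) * ψ s := by
  refine stableNorm_le fun r hr => ?_
  have h₁ : L r t ((∫ s in A, (L t s (g s) - Q t (L t s (g s)))) -
      Q t (∫ s in A, (L t s (g s) - Q t (L t s (g s))))) =
      ∫ s in A, L r t (L t s (g s) - Q t (L t s (g s))) := by
    rw [ContinuousLinearMap.integral_comp_comm _ hg, ← ContinuousLinearMap.integral_comp_comm _ hg]
    congr 1
    simp [proj_proj hQ]
  rw [h₁, ← integral_const_mul]
  refine norm_integral_le_of_norm_le (hψ.const_mul _) ?_
  refine (ae_restrict_iff' hA).2 (Eventually.of_forall fun s hs => ?_)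
  have hst : s ≤ t := hAt hs
  rw [proj_evolution hQ hst, ← map_sub, evolution_comp hL hst hr]
  refine (norm_stable_le hQ (hst.trans hr) _).trans ?_
  rw [← mul_assoc, ← Real.exp_add, show -γ * (r - t) + -γ * (t - s) = -γ * (r - s) by ring]
  exact mul_le_mul_of_nonneg_left (hgψ s hs) (Real.exp_pos _).le

lemma stableNorm_intervalIntegral_le [CompleteSpace X] (hL : IsLinearEvolutionProcess L)
    (hQ : HasExponentialSplitting L Q M γ ρ) {g : ℝ → X} {ψ : ℝ → ℝ} {r t : ℝ} (h : r ≤ t)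
    (hg : ContinuousOn g (Icc r t)) (hψ : ContinuousOn ψ (Icc r t))
    (hgψ : ∀ s ∈ Icc r t, stableNorm L Q γ s (g s) ≤ ψ s) :
    stableNorm L Q γ t (∫ s in r..t, L t s (g s)) ≤
      ∫ s in r..t, Real.exp (-γ * (t - s)) * ψ s := by
  have hc := continuousOn_integrand hL hg
  have hi : IntegrableOn (fun s => L t s (g s)) (Ioc r t) :=
    (hc.integrableOn_Icc).mono_set Ioc_subset_Icc_self
  have hi' : IntegrableOn (fun s => Q t (L t s (g s))) (Ioc r t) :=
    (((Q t).continuous.comp_continuousOn hc).integrableOn_Icc).mono_set Ioc_subset_Icc_self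
  rw [intervalIntegral.integral_of_le h, intervalIntegral.integral_of_le h]
  have := stableNorm_integral_le hL hQ (g := g) (ψ := ψ) measurableSet_Ioc
    (fun s (hs : s ∈ Ioc r t) => hs.2) (hi.sub hi')
    (ContinuousOn.integrableOn_Icc (by fun_prop) |>.mono_set Ioc_subset_Icc_self)
    (fun s hs => hgψ s (Ioc_subset_Icc_self hs))
  refine le_of_eq_of_le (stableNorm_congr ?_) this
  rw [integral_sub hi hi', ContinuousLinearMap.integral_comp_comm _ hi]
  simp [proj_proj hQ]

end Linear

end InvMan

namespace InvMan

open Set Filter Topology MeasureTheory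

section Scalar

/-! ### Admissible norms on the plane -/

variable {Γ : Seminorm ℝ (ℝ × ℝ)}

lemma IsAdmissible.mono (hΓ : IsAdmissible Γ) {a b c d : ℝ} (ha : 0 ≤ a) (hb : 0 ≤ b)
    (hac : a ≤ c) (hbd : b ≤ d) : Γ (a, b) ≤ Γ (c, d) :=
  (hΓ.mono_fst b hb (mem_Ici.2 ha) (mem_Ici.2 (ha.trans hac)) hac).trans
    (hΓ.mono_snd c (ha.trans hac) (mem_Ici.2 hb) (mem_Ici.2 (hb.trans hbd)) hbd)

lemma IsAdmissible.pos (hΓ : IsAdmissible Γ) {x : ℝ × ℝ} (hx : x ≠ 0) : 0 < Γ x :=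
  (apply_nonneg Γ x).lt_of_ne fun h => hx (hΓ.definite x h.symm)

lemma IsAdmissible.pos_one_zero (hΓ : IsAdmissible Γ) : 0 < Γ (1, 0) := hΓ.pos (by simp)

lemma IsAdmissible.pos_zero_one (hΓ : IsAdmissible Γ) : 0 < Γ (0, 1) := hΓ.pos (by simp)

lemma IsAdmissible.pos_one (hΓ : IsAdmissible Γ) (k : ℝ) : 0 < Γ (1, k) := hΓ.pos (by simp)

lemma seminorm_mul_mul {c : ℝ} (hc : 0 ≤ c) (a b : ℝ) : Γ (c * a, c * b) = c * Γ (a, b) := by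
  have := map_smul_eq_mul Γ c (a, b)
  rwa [Real.norm_of_nonneg hc, Prod.smul_mk, smul_eq_mul, smul_eq_mul] at this

lemma seminorm_add_le (a b c d : ℝ) : Γ (a + c, b + d) ≤ Γ (a, b) + Γ (c, d) := by
  simpa using map_add_le_add Γ (a, b) (c, d)

lemma IsAdmissible.fst_mul_le (hΓ : IsAdmissible Γ) {a b : ℝ} (ha : 0 ≤ a) (hb : 0 ≤ b) :
    a * Γ (1, 0) ≤ Γ (a, b) := by
  rw [← seminorm_mul_mul ha]
  exact hΓ.mono (by simpa) (by simp) (by simp) (by simpa)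

lemma IsAdmissible.snd_mul_le (hΓ : IsAdmissible Γ) {a b : ℝ} (ha : 0 ≤ a) (hb : 0 ≤ b) :
    b * Γ (0, 1) ≤ Γ (a, b) := by
  rw [← seminorm_mul_mul hb]
  exact hΓ.mono (by simp) (by simpa) (by simpa) (by simp)

lemma continuous_seminorm_one : Continuous fun k : ℝ => Γ (1, k) := by
  have h (k l : ℝ) : Γ (1, k) - Γ (1, l) ≤ Γ (0, 1) * |k - l| := by
    have h₁ := seminorm_add_le (Γ := Γ) 1 l 0 (k - l)
    have h₂ := map_smul_eq_mul Γ (k - l) ((0 : ℝ), (1 : ℝ))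
    rw [Prod.smul_mk, smul_zero, smul_eq_mul, mul_one, Real.norm_eq_abs] at h₂
    rw [add_zero, add_sub_cancel, h₂] at h₁
    linarith
  refine (LipschitzWith.of_dist_le_mul (K := (Γ (0, 1)).toNNReal) fun k l => ?_).continuous
  rw [Real.dist_eq, Real.dist_eq, Real.coe_toNNReal _ (apply_nonneg _ _), abs_le]
  have := h l k
  rw [abs_sub_comm] at this
  exact ⟨by linarith, h k l⟩

lemma seminorm_inv_one {k : ℝ} (hk : 0 < k) : Γ (1 / k, 1) = Γ (1, k) / k := by
  rw [div_eq_inv_mul (Γ (1, k)), ← seminorm_mul_mul (inv_pos.2 hk).le]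
  congr 2
  · simp
  · field_simp

/-! ### The slope equation and the gap condition -/

lemma mem_kappaRoots {γ ρ L₁ L₂ k : ℝ} : k ∈ kappaRoots Γ γ ρ L₁ L₂ ↔
    0 < k ∧ (L₁ + L₂ / k) * Γ (1, k) = γ - ρ := by
  refine and_congr_right fun hk => ?_
  rw [seminorm_inv_one hk, eq_comm, add_mul, div_mul_eq_mul_div, mul_div_assoc]

/-- Homogeneity of `Γ`: the second argument in the gap condition is the first one times the ratio
`k₀ = (L₂/L₁)(σ-ρ)/(γ-σ)`. -/
lemma gap_at_ratio {γ ρ σ L₁ L₂ : ℝ} (hL₁ : 0 < L₁)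
    (hσ : σ ∈ Ioo ρ γ) (hgap : Γ (L₁ / (σ - ρ), L₂ / (γ - σ)) < 1) :
    L₁ * Γ (1, L₂ / L₁ * ((σ - ρ) / (γ - σ))) < σ - ρ := by
  have h₁ : 0 < σ - ρ := sub_pos.2 hσ.1
  have h₂ : 0 < γ - σ := sub_pos.2 hσ.2
  have h : Γ (L₁ / (σ - ρ), L₂ / (γ - σ)) =
      L₁ / (σ - ρ) * Γ (1, L₂ / L₁ * ((σ - ρ) / (γ - σ))) := by
    rw [← seminorm_mul_mul (by positivity)]
    congr 2
    · simp
    · field_simp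
  rwa [h, div_mul_eq_mul_div, div_lt_one h₁] at hgap

lemma gap_at_ratio' {γ ρ σ L₁ L₂ : ℝ} (hL₁ : 0 < L₁) (hL₂ : 0 < L₂)
    (hσ : σ ∈ Ioo ρ γ) (hgap : Γ (L₁ / (σ - ρ), L₂ / (γ - σ)) < 1) :
    (L₁ + L₂ / (L₂ / L₁ * ((σ - ρ) / (γ - σ)))) * Γ (1, L₂ / L₁ * ((σ - ρ) / (γ - σ))) < γ - ρ := by
  have h₁ : 0 < σ - ρ := sub_pos.2 hσ.1
  have h₂ : 0 < γ - σ := sub_pos.2 hσ.2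
  have h := gap_at_ratio hL₁ hσ hgap
  have e : L₁ + L₂ / (L₂ / L₁ * ((σ - ρ) / (γ - σ))) = L₁ * ((γ - ρ) / (σ - ρ)) := by
    field_simp
    ring
  rw [e, mul_right_comm, ← mul_div_assoc, div_lt_iff₀ h₁, mul_comm]
  exact mul_lt_mul_of_pos_left h (by linarith)

/-- The function `(L₁ + L₂/k) Γ (1, k)` exceeds `L₂ Γ (1, 0)/k`, hence exceeds `γ - ρ` for `k ≤ k₁`,
while the gap condition puts it below `γ - ρ` at `k₀`. The intermediate value theorem gives a root
in between. -/
lemma exists_isLeast_kappaRoots (hΓ : IsAdmissible Γ) {γ ρ σ L₁ L₂ : ℝ} (hL₁ : 0 < L₁)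
    (hL₂ : 0 < L₂) (hσ : σ ∈ Ioo ρ γ) (hgap : Γ (L₁ / (σ - ρ), L₂ / (γ - σ)) < 1) :
    ∃ κ, IsLeast (kappaRoots Γ γ ρ L₁ L₂) κ ∧ κ < L₂ / L₁ * ((σ - ρ) / (γ - σ)) := by
  have h₁ : 0 < σ - ρ := sub_pos.2 hσ.1
  have h₂ : 0 < γ - σ := sub_pos.2 hσ.2
  have hδ : 0 < γ - ρ := by linarith
  have hgap' := gap_at_ratio' hL₁ hL₂ hσ hgap
  set k₀ := L₂ / L₁ * ((σ - ρ) / (γ - σ))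
  have hk₀ : 0 < k₀ := by positivity
  have hΓ₁ := hΓ.pos_one_zero
  set k₁ := L₂ * Γ (1, 0) / (γ - ρ) with hk₁_def
  have hk₁ : 0 < k₁ := by positivity
  have hlow : ∀ k, 0 < k → L₂ * Γ (1, 0) / k < (L₁ + L₂ / k) * Γ (1, k) := by
    intro k hk
    have : Γ (1, 0) ≤ Γ (1, k) := hΓ.mono zero_le_one le_rfl le_rfl hk.le
    calc L₂ * Γ (1, 0) / k = L₂ / k * Γ (1, 0) := by ring
      _ ≤ L₂ / k * Γ (1, k) := by gcongr
      _ < _ := by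
        have := hΓ.pos_one k
        have := mul_pos hL₁ this
        linarith
  have hlt : ∀ k, 0 < k → (L₁ + L₂ / k) * Γ (1, k) ≤ γ - ρ → k₁ < k := by
    intro k hk h
    have := (hlow k hk).trans_le h
    rw [div_lt_iff₀ hk] at this
    rw [hk₁_def, div_lt_iff₀ hδ]
    linarith
  have hk₁₀ : k₁ < k₀ := hlt k₀ hk₀ hgap'.le
  have hcont : ContinuousOn (fun k => (L₁ + L₂ / k) * Γ (1, k)) (Icc k₁ k₀) := by
    refine ContinuousOn.mul ?_ continuous_seminorm_one.continuousOn
    exact continuousOn_const.add (continuousOn_const.div continuousOn_id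
      fun k hk => (hk₁.trans_le hk.1).ne')
  have hmid : γ - ρ ∈ Icc ((L₁ + L₂ / k₀) * Γ (1, k₀)) ((L₁ + L₂ / k₁) * Γ (1, k₁)) := by
    refine ⟨hgap'.le, ?_⟩
    have := hlow k₁ hk₁
    have e : L₂ * Γ (1, 0) / k₁ = γ - ρ := by rw [hk₁_def]; field_simp
    linarith
  obtain ⟨k, hk, hkeq⟩ := intermediate_value_Icc' hk₁₀.le hcont hmid
  -- No root lies at or below `k₁`, so the minimum of this compact set is the least root on all of
  -- `(0, ∞)`.
  set S := Icc k₁ k₀ ∩ (fun k => (L₁ + L₂ / k) * Γ (1, k)) ⁻¹' {γ - ρ}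
  have hS : IsCompact S := isCompact_Icc.of_isClosed_subset
    (hcont.preimage_isClosed_of_isClosed isClosed_Icc isClosed_singleton) inter_subset_left
  obtain ⟨κ, ⟨hκ, hκeq⟩, hmin⟩ := hS.exists_isLeast ⟨k, hk, hkeq⟩
  have hκeq' : (L₁ + L₂ / κ) * Γ (1, κ) = γ - ρ := hκeq
  refine ⟨κ, ⟨mem_kappaRoots.2 ⟨hk₁.trans_le hκ.1, hκeq'⟩, fun l hl => ?_⟩, ?_⟩
  · obtain ⟨hl0, hleq⟩ := mem_kappaRoots.1 hl
    rcases le_total l k₀ with h | h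
    · exact hmin ⟨⟨(hlt l hl0 hleq.le).le, h⟩, hleq⟩
    · exact hκ.2.trans h
  · refine hκ.2.lt_of_ne fun h => ?_
    rw [h] at hκeq'
    linarith

/-- The attraction exponent lies strictly above `ρ`. -/
lemma mul_seminorm_zero_one_lt (hΓ : IsAdmissible Γ) {γ ρ σ L₁ L₂ κ : ℝ} (hL₁ : 0 < L₁)
    (hL₂ : 0 < L₂) (hσ : σ ∈ Ioo ρ γ) (hgap : Γ (L₁ / (σ - ρ), L₂ / (γ - σ)) < 1)
    (hκ : κ ∈ kappaRoots Γ γ ρ L₁ L₂) (hκσ : κ < L₂ / L₁ * ((σ - ρ) / (γ - σ))) :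
    (L₂ + κ * L₁) * Γ (0, 1) < γ - ρ := by
  obtain ⟨hκ0, hκeq⟩ := mem_kappaRoots.1 hκ
  have hgap' := gap_at_ratio' hL₁ hL₂ hσ hgap
  set k₀ := L₂ / L₁ * ((σ - ρ) / (γ - σ))
  have hk₀ : 0 < k₀ := hκ0.trans hκσ
  have e : ∀ k, 0 < k → (L₁ + L₂ / k) * Γ (1, k) = L₁ * Γ (1, k) + L₂ * Γ (1 / k, 1) := by
    intro k hk
    rw [seminorm_inv_one hk]
    ring
  rw [e k₀ hk₀] at hgap'
  have h₁ : Γ (0, 1) ≤ Γ (1 / k₀, 1) := hΓ.mono le_rfl zero_le_one (by positivity) le_rfl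
  have h₂ : Γ (1, κ) ≤ Γ (1, k₀) := hΓ.mono zero_le_one hκ0.le le_rfl hκσ.le
  -- Admissibility gives only `≤`. Equality would make the right-hand side of the slope equation at
  -- `κ` at most its value at `k₀`, which is below `γ - ρ`.
  have h₃ : Γ (0, 1) < Γ (1 / κ, 1) := by
    by_contra! h
    have hκeq' := hκeq
    rw [e κ hκ0] at hκeq'
    have : L₁ * Γ (1, κ) + L₂ * Γ (1 / κ, 1) ≤ L₁ * Γ (1, k₀) + L₂ * Γ (1 / k₀, 1) := by
      gcongr
      exact h.trans h₁
    linarith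
  calc (L₂ + κ * L₁) * Γ (0, 1) < (L₂ + κ * L₁) * Γ (1 / κ, 1) := by gcongr
    _ = γ - ρ := by
      rw [seminorm_inv_one hκ0, ← hκeq]
      field_simp
      ring

/-! ### Exponential integrals -/

lemma hasDerivAt_exp_mul_exp (γ ν t τ s : ℝ) :
    HasDerivAt (fun s => Real.exp (-γ * (t - s)) * Real.exp (-ν * (s - τ)))
      ((γ - ν) * (Real.exp (-γ * (t - s)) * Real.exp (-ν * (s - τ)))) s := by
  have h₁ : HasDerivAt (fun s => -γ * (t - s)) γ s := by
    simpa using ((hasDerivAt_id s).const_sub t).const_mul (-γ)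
  have h₂ : HasDerivAt (fun s => -ν * (s - τ)) (-ν) s := by
    simpa using ((hasDerivAt_id s).sub_const τ).const_mul (-ν)
  exact (h₁.exp.mul h₂.exp).congr_deriv (by ring)

lemma integral_exp_mul_exp {γ ν : ℝ} (h : γ ≠ ν) (t τ a b : ℝ) :
    ∫ s in a..b, Real.exp (-γ * (t - s)) * Real.exp (-ν * (s - τ)) =
      (Real.exp (-γ * (t - b)) * Real.exp (-ν * (b - τ)) -
        Real.exp (-γ * (t - a)) * Real.exp (-ν * (a - τ))) / (γ - ν) := by
  have h' : γ - ν ≠ 0 := sub_ne_zero.2 h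
  rw [eq_div_iff h', mul_comm, ← intervalIntegral.integral_const_mul]
  exact intervalIntegral.integral_eq_sub_of_hasDerivAt
    (fun s _ => hasDerivAt_exp_mul_exp γ ν t τ s)
    (Continuous.intervalIntegrable (by fun_prop) _ _)

lemma integral_exp_backward {ρ ν : ℝ} (h : ρ < ν) (t τ : ℝ) :
    ∫ s in t..τ, Real.exp (-ρ * (t - s)) * Real.exp (-ν * (s - τ)) =
      (Real.exp (-ν * (t - τ)) - Real.exp (-ρ * (t - τ))) / (ν - ρ) := by
  rw [integral_exp_mul_exp h.ne, ← neg_div_neg_eq]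
  simp

lemma integral_exp_forward {γ ν : ℝ} (h : ν < γ) (t τ : ℝ) :
    ∫ s in τ..t, Real.exp (-γ * (t - s)) * Real.exp (-ν * (s - τ)) =
      (Real.exp (-ν * (t - τ)) - Real.exp (-γ * (t - τ))) / (γ - ν) := by
  rw [integral_exp_mul_exp h.ne']
  simp

lemma integral_exp_le {γ ν : ℝ} (h : ν < γ) (r t τ : ℝ) :
    ∫ s in r..t, Real.exp (-γ * (t - s)) * Real.exp (-ν * (s - τ)) ≤
      Real.exp (-ν * (t - τ)) / (γ - ν) := by
  have : 0 < γ - ν := sub_pos.2 h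
  rw [integral_exp_mul_exp h.ne']
  gcongr
  simp
  positivity

lemma exp_mul_exp_eq (γ ν t τ s : ℝ) :
    Real.exp (-γ * (t - s)) * Real.exp (-ν * (s - τ)) =
      Real.exp (-γ * t + ν * τ) * Real.exp ((γ - ν) * s) := by
  rw [← Real.exp_add, ← Real.exp_add]
  congr 1
  ring

lemma integrableOn_exp_mul_exp {γ ν : ℝ} (h : ν < γ) (t τ c : ℝ) :
    IntegrableOn (fun s => Real.exp (-γ * (t - s)) * Real.exp (-ν * (s - τ))) (Iic c) := by
  simp_rw [exp_mul_exp_eq]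
  exact (integrableOn_exp_mul_Iic (sub_pos.2 h) c).const_mul _

lemma setIntegral_exp_mul_exp {γ ν : ℝ} (h : ν < γ) (t τ : ℝ) :
    ∫ s in Iic t, Real.exp (-γ * (t - s)) * Real.exp (-ν * (s - τ)) =
      Real.exp (-ν * (t - τ)) / (γ - ν) := by
  simp_rw [exp_mul_exp_eq]
  rw [integral_const_mul, integral_exp_mul_Iic (sub_pos.2 h), ← mul_div_assoc, ← Real.exp_add]
  ring_nf

/-- If a family of majorants `m + K w` can be improved from `K` to `θ K` with `θ < 1`, the
remainder `K w` can be dropped. -/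
lemma le_of_contracting {C : ℝ → Prop} {θ : ℝ} (hθ : 0 ≤ θ) (hθ' : θ < 1)
    (step : ∀ K, 0 ≤ K → C K → C (θ * K)) {K₀ : ℝ} (hK₀ : 0 ≤ K₀) (h₀ : C K₀) {x m w : ℝ}
    (hC : ∀ K, 0 ≤ K → C K → x ≤ m + K * w) : x ≤ m := by
  have h : ∀ n : ℕ, C (θ ^ n * K₀) := by
    intro n
    induction n with
    | zero => simpa using h₀
    | succ n ih =>
      rw [pow_succ', mul_assoc]
      exact step _ (by positivity) ih
  have hlim : Tendsto (fun n : ℕ => m + θ ^ n * K₀ * w) atTop (𝓝 (m + 0 * K₀ * w)) :=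
    (((tendsto_pow_atTop_nhds_zero_of_lt_one hθ hθ').mul_const K₀).mul_const w).const_add m
  rw [zero_mul, zero_mul, add_zero] at hlim
  exact ge_of_tendsto' hlim fun n => hC _ (by positivity) (h n)

end Scalar

end InvMan

namespace InvMan

open Set Filter Topology MeasureTheory

/-! ### Mild solutions, the standing hypotheses, and estimates for differences -/

section Mild

variable {X : Type*} [NormedAddCommGroup X] [NormedSpace ℝ X]
  {L : ℝ → ℝ → X →L[ℝ] X} {Q : ℝ → X →L[ℝ] X} {M γ ρ : ℝ} {Γ : Seminorm ℝ (ℝ × ℝ)}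
  {f : ℝ → X → X} {L₁ L₂ : ℝ} {T : ℝ → ℝ → X → X} {σ κ : ℝ}

/-- Continuous solutions of the variation of constants formula on the interval `I`. -/
structure IsMildOn (L : ℝ → ℝ → X →L[ℝ] X) (f : ℝ → X → X) (z : ℝ → X) (I : Set ℝ) : Prop where
  cont : ContinuousOn z I
  eq : ∀ s ∈ I, ∀ t ∈ I, s ≤ t → z t = L t s (z s) + ∫ r in s..t, L t r (f r (z r))

lemma IsMildOn.mono {z : ℝ → X} {I J : Set ℝ} (h : IsMildOn L f z I) (hJ : J ⊆ I) :
    IsMildOn L f z J :=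
  ⟨h.cont.mono hJ, fun s hs t ht hst => h.eq s (hJ hs) t (hJ ht) hst⟩

/-- The linear process `L` with exponential splitting, the adapted-Lipschitz nonlinearity `f` and
the process `T` generated by them. -/
structure IsSemilinear (L : ℝ → ℝ → X →L[ℝ] X) (Q : ℝ → X →L[ℝ] X) (M γ ρ : ℝ)
    (Γ : Seminorm ℝ (ℝ × ℝ)) (f : ℝ → X → X) (L₁ L₂ : ℝ) (T : ℝ → ℝ → X → X) : Prop where
  evol : IsLinearEvolutionProcess L
  splitting : HasExponentialSplitting L Q M γ ρ
  admissible : IsAdmissible Γ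
  cont : Continuous (Function.uncurry f)
  zero : ∀ t : ℝ, f t 0 = 0
  pos₁ : 0 < L₁
  pos₂ : 0 < L₂
  unstable_le : ∀ (t : ℝ) (u v : X),
    unstableNorm L Q ρ t (f t u - f t v) ≤ L₁ * adaptedNorm Γ L Q γ ρ t (u - v)
  stable_le : ∀ (t : ℝ) (u v : X),
    stableNorm L Q γ t (f t u - f t v) ≤ L₂ * adaptedNorm Γ L Q γ ρ t (u - v)
  process : IsEvolutionProcess T
  vcf : ∀ (t τ : ℝ), τ ≤ t → ∀ η : X, T t τ η = L t τ η + ∫ s in τ..t, L t s (f s (T s τ η))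

/-- The numerical consequences of the gap condition at `σ` for the slope `κ`. -/
structure IsGap (Γ : Seminorm ℝ (ℝ × ℝ)) (γ ρ L₁ L₂ σ κ : ℝ) : Prop where
  lt_left : ρ < σ
  lt_right : σ < γ
  gap : Γ (L₁ / (σ - ρ), L₂ / (γ - σ)) < 1
  pos : 0 < κ
  rate_lt : ρ + L₁ * Γ (1, κ) < σ
  slope_eq : L₂ * Γ (1, κ) = κ * (γ - (ρ + L₁ * Γ (1, κ)))
  attraction : (L₂ + κ * L₁) * Γ (0, 1) < γ - ρ

lemma exists_isGap (hΓ : IsAdmissible Γ) (hL₁ : 0 < L₁) (hL₂ : 0 < L₂) (hσ : σ ∈ Ioo ρ γ)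
    (hgap : Γ (L₁ / (σ - ρ), L₂ / (γ - σ)) < 1) :
    ∃ κ, IsLeast (kappaRoots Γ γ ρ L₁ L₂) κ ∧ κ < L₂ / L₁ * ((σ - ρ) / (γ - σ)) ∧
      IsGap Γ γ ρ L₁ L₂ σ κ := by
  obtain ⟨κ, hκ, hκσ⟩ := exists_isLeast_kappaRoots hΓ hL₁ hL₂ hσ hgap
  obtain ⟨hκ0, hκeq⟩ := mem_kappaRoots.1 hκ.1
  refine ⟨κ, hκ, hκσ, hσ.1, hσ.2, hgap, hκ0, ?_, ?_,
    mul_seminorm_zero_one_lt hΓ hL₁ hL₂ hσ hgap hκ.1 hκσ⟩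
  · have h₁ := gap_at_ratio hL₁ hσ hgap
    have h₂ : Γ (1, κ) ≤ _ := hΓ.mono zero_le_one hκ0.le le_rfl hκσ.le
    have := mul_le_mul_of_nonneg_left h₂ hL₁.le
    linarith
  · rw [← sub_sub, ← hκeq]
    field_simp
    ring

lemma adaptedNorm_nonneg (τ : ℝ) (x : X) : 0 ≤ adaptedNorm Γ L Q γ ρ τ x := apply_nonneg Γ _

lemma adaptedNorm_le (hΓ : IsAdmissible Γ) {τ p q : ℝ} {x : X}
    (hp : unstableNorm L Q ρ τ x ≤ p) (hq : stableNorm L Q γ τ x ≤ q) :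
    adaptedNorm Γ L Q γ ρ τ x ≤ Γ (p, q) :=
  hΓ.mono (unstableNorm_nonneg _ _) (stableNorm_nonneg _ _) hp hq

lemma exists_growth_bound {z : ℝ → X} {τ : ℝ}
    (hz : HasBackwardGrowth Γ L Q γ ρ σ z τ) :
    ∃ C, 0 ≤ C ∧ ∀ r ≤ τ, adaptedNorm Γ L Q γ ρ r (z r) ≤ C * Real.exp (-σ * (r - τ)) := by
  obtain ⟨C, hC⟩ := hz
  have hC' : ∀ r ≤ τ, Real.exp (σ * r) * adaptedNorm Γ L Q γ ρ r (z r) ≤ C :=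
    fun r hr => hC ⟨r, hr, rfl⟩
  have hC0 : 0 ≤ C := (mul_nonneg (Real.exp_pos _).le (adaptedNorm_nonneg _ _)).trans (hC' τ le_rfl)
  refine ⟨C * Real.exp (-σ * τ), by positivity, fun r hr => ?_⟩
  have := hC' r hr
  rw [mul_assoc, ← Real.exp_add, show -σ * τ + -σ * (r - τ) = -(σ * r) by ring, Real.exp_neg,
    ← div_eq_mul_inv, le_div_iff₀ (Real.exp_pos _), mul_comm]
  exact this

lemma hasBackwardGrowth_of_le {z : ℝ → X} {τ C : ℝ}
    (h : ∀ r ≤ τ, adaptedNorm Γ L Q γ ρ r (z r) ≤ C * Real.exp (-σ * (r - τ))) :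
    HasBackwardGrowth Γ L Q γ ρ σ z τ := by
  refine ⟨C * Real.exp (σ * τ), ?_⟩
  rintro _ ⟨r, hr, rfl⟩
  calc Real.exp (σ * r) * adaptedNorm Γ L Q γ ρ r (z r)
      ≤ Real.exp (σ * r) * (C * Real.exp (-σ * (r - τ))) := by gcongr; exact h r hr
    _ = C * Real.exp (σ * τ) := by
      rw [mul_left_comm, ← Real.exp_add]
      ring_nf

namespace IsSemilinear

lemma adaptedNorm_le_norm (H : IsSemilinear L Q M γ ρ Γ f L₁ L₂ T) (τ : ℝ) (x : X) :
    adaptedNorm Γ L Q γ ρ τ x ≤ M * Γ (1, 1) * ‖x‖ := by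
  refine (adaptedNorm_le H.admissible (unstableNorm_le_norm H.splitting τ x)
    (stableNorm_le_norm H.splitting τ x)).trans_eq ?_
  have h := seminorm_mul_mul (Γ := Γ)
    (mul_nonneg (zero_le_bound H.splitting) (norm_nonneg x)) 1 1
  rw [mul_one] at h
  rw [h]
  ring

lemma unstableNorm_le_adaptedNorm (H : IsSemilinear L Q M γ ρ Γ f L₁ L₂ T) (τ : ℝ) (x : X) :
    unstableNorm L Q ρ τ x * Γ (1, 0) ≤ adaptedNorm Γ L Q γ ρ τ x :=
  H.admissible.fst_mul_le (unstableNorm_nonneg _ _) (stableNorm_nonneg _ _)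

lemma stableNorm_le_adaptedNorm (H : IsSemilinear L Q M γ ρ Γ f L₁ L₂ T) (τ : ℝ) (x : X) :
    stableNorm L Q γ τ x * Γ (0, 1) ≤ adaptedNorm Γ L Q γ ρ τ x :=
  H.admissible.snd_mul_le (unstableNorm_nonneg _ _) (stableNorm_nonneg _ _)

lemma exists_norm_le_adaptedNorm (H : IsSemilinear L Q M γ ρ Γ f L₁ L₂ T) :
    ∃ C, 0 < C ∧ ∀ (τ : ℝ) (x : X), ‖x‖ ≤ C * adaptedNorm Γ L Q γ ρ τ x := by
  have h₁ := H.admissible.pos_one_zero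
  have h₂ := H.admissible.pos_zero_one
  refine ⟨1 / Γ (1, 0) + 1 / Γ (0, 1), by positivity, fun τ x => ?_⟩
  refine (norm_le_add H.evol H.splitting τ x).trans ?_
  have h₃ := (le_div_iff₀ h₁).2 (H.unstableNorm_le_adaptedNorm τ x)
  have h₄ := (le_div_iff₀ h₂).2 (H.stableNorm_le_adaptedNorm τ x)
  calc _ ≤ _ := add_le_add h₃ h₄
    _ = _ := by ring

lemma exists_lipschitz (H : IsSemilinear L Q M γ ρ Γ f L₁ L₂ T) :
    ∃ C, 0 < C ∧ ∀ (t : ℝ) (u v : X), ‖f t u - f t v‖ ≤ C * ‖u - v‖ := by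
  have h₁ := H.pos₁
  have h₂ := H.pos₂
  have h₃ : 0 < Γ (1, 1) := H.admissible.pos_one 1
  have h₄ : 0 < M := zero_lt_one.trans_le H.splitting.one_le
  refine ⟨(L₁ + L₂) * (M * Γ (1, 1)), by positivity, fun t u v => ?_⟩
  calc ‖f t u - f t v‖ ≤ _ := norm_le_add H.evol H.splitting t _
    _ ≤ _ := add_le_add (H.unstable_le t u v) (H.stable_le t u v)
    _ = (L₁ + L₂) * adaptedNorm Γ L Q γ ρ t (u - v) := by ring
    _ ≤ (L₁ + L₂) * (M * Γ (1, 1) * ‖u - v‖) := by gcongr; exact H.adaptedNorm_le_norm t _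
    _ = _ := by ring

lemma continuousOn_nonlinearity (H : IsSemilinear L Q M γ ρ Γ f L₁ L₂ T) {z : ℝ → X} {I : Set ℝ}
    (hz : ContinuousOn z I) : ContinuousOn (fun r => f r (z r)) I :=
  H.cont.comp_continuousOn (continuousOn_id.prodMk hz)

lemma isMildOn_process (H : IsSemilinear L Q M γ ρ Γ f L₁ L₂ T) (τ : ℝ) (η : X) :
    IsMildOn L f (fun t => T t τ η) (Ici τ) := by
  refine ⟨H.process.cont τ η, fun s hs t ht hst => ?_⟩
  have h := H.vcf t s hst (T s τ η)
  rw [H.process.comp t s τ hs hst] at h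
  rw [h]
  congr 1
  refine intervalIntegral.integral_congr fun r hr => ?_
  rw [uIcc_of_le hst] at hr
  rw [H.process.comp r s τ hs hr.1]

lemma isMildOn_globalSolution (H : IsSemilinear L Q M γ ρ Γ f L₁ L₂ T) {z : ℝ → X}
    (hz : IsGlobalSolution T z) : IsMildOn L f z univ := by
  have h (s : ℝ) : IsMildOn L f z (Ici s) := by
    have h' := H.isMildOn_process s (z s)
    refine ⟨h'.cont.congr fun t ht => (hz t s ht).symm, fun r hr t ht hrt => ?_⟩
    have := h'.eq r hr t ht hrt
    rw [hz t s ht, hz r s hr] at this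
    rw [this]
    congr 1
    refine intervalIntegral.integral_congr fun u hu => ?_
    rw [uIcc_of_le hrt] at hu
    rw [hz u s (le_trans hr hu.1)]
  refine ⟨?_, fun s _ t _ hst => (h s).eq s self_mem_Ici t hst hst⟩
  rw [continuousOn_univ, continuous_iff_continuousAt]
  exact fun t => (h (t - 1)).cont.continuousAt (Ici_mem_nhds (sub_one_lt t))

lemma mild_sub_eq [CompleteSpace X] (H : IsSemilinear L Q M γ ρ Γ f L₁ L₂ T) {y z : ℝ → X}
    {s t : ℝ} (hst : s ≤ t) (hz : IsMildOn L f z (Icc s t)) (hy : IsMildOn L f y (Icc s t)) :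
    z t - y t = L t s (z s - y s) + ∫ r in s..t, L t r (f r (z r) - f r (y r)) := by
  have hs : s ∈ Icc s t := left_mem_Icc.2 hst
  have ht : t ∈ Icc s t := right_mem_Icc.2 hst
  rw [hz.eq s hs t ht hst, hy.eq s hs t ht hst]
  simp only [map_sub]
  rw [intervalIntegral.integral_sub
    (intervalIntegrable_integrand H.evol hst (H.continuousOn_nonlinearity hz.cont))
    (intervalIntegrable_integrand H.evol hst (H.continuousOn_nonlinearity hy.cont))]
  abel

/-- `L` is invertible on the unstable part, so the variation of constants formula can be solved for
the unstable component at the earlier time. -/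
lemma unstableNorm_mild_sub_le [CompleteSpace X] (H : IsSemilinear L Q M γ ρ Γ f L₁ L₂ T)
    {y z : ℝ → X} {s t : ℝ} (hst : s ≤ t) (hz : IsMildOn L f z (Icc s t))
    (hy : IsMildOn L f y (Icc s t)) {ψ : ℝ → ℝ} (hψ : ContinuousOn ψ (Icc s t))
    (h : ∀ r ∈ Icc s t, adaptedNorm Γ L Q γ ρ r (z r - y r) ≤ ψ r) :
    unstableNorm L Q ρ s (z s - y s) ≤
      Real.exp (-ρ * (s - t)) * unstableNorm L Q ρ t (z t - y t) +
        L₁ * ∫ r in s..t, Real.exp (-ρ * (s - r)) * ψ r := by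
  have hL₁ := H.pos₁
  have e : Q s (z s - y s) = unstableBack L Q s t (z t - y t) +
      -unstableBack L Q s t (∫ r in s..t, L t r (f r (z r) - f r (y r))) := by
    rw [H.mild_sub_eq hst hz hy, map_add, unstableBack_evolution_self H.evol H.splitting hst]
    abel
  rw [← unstableNorm_proj H.splitting, e]
  refine (unstableNorm_add_le H.splitting _ _ _).trans (add_le_add ?_ ?_)
  · exact unstableNorm_unstableBack_le H.evol H.splitting hst _
  · rw [unstableNorm_neg H.splitting]
    refine (unstableNorm_integral_le (ψ := fun r => L₁ * ψ r) H.evol H.splitting hst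
      ((H.continuousOn_nonlinearity hz.cont).sub (H.continuousOn_nonlinearity hy.cont))
      (by fun_prop) fun r hr => (H.unstable_le r _ _).trans ?_).trans_eq ?_
    · exact mul_le_mul_of_nonneg_left (h r hr) hL₁.le
    · rw [← intervalIntegral.integral_const_mul]
      congr 1
      ext r
      ring

lemma stableNorm_mild_sub_le [CompleteSpace X] (H : IsSemilinear L Q M γ ρ Γ f L₁ L₂ T)
    {y z : ℝ → X} {s t : ℝ} (hst : s ≤ t) (hz : IsMildOn L f z (Icc s t))
    (hy : IsMildOn L f y (Icc s t)) {ψ : ℝ → ℝ} (hψ : ContinuousOn ψ (Icc s t))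
    (h : ∀ r ∈ Icc s t, adaptedNorm Γ L Q γ ρ r (z r - y r) ≤ ψ r) :
    stableNorm L Q γ t (z t - y t) ≤
      Real.exp (-γ * (t - s)) * stableNorm L Q γ s (z s - y s) +
        L₂ * ∫ r in s..t, Real.exp (-γ * (t - r)) * ψ r := by
  have hL₂ := H.pos₂
  rw [H.mild_sub_eq hst hz hy]
  refine (stableNorm_add_le H.splitting _ _ _).trans (add_le_add ?_ ?_)
  · exact stableNorm_evolution_le H.evol H.splitting hst _
  · refine (stableNorm_intervalIntegral_le (ψ := fun r => L₂ * ψ r) H.evol H.splitting hst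
      ((H.continuousOn_nonlinearity hz.cont).sub (H.continuousOn_nonlinearity hy.cont))
      (by fun_prop) fun r hr => (H.stable_le r _ _).trans ?_).trans_eq ?_
    · exact mul_le_mul_of_nonneg_left (h r hr) hL₂.le
    · rw [← intervalIntegral.integral_const_mul]
      congr 1
      ext r
      ring

/-- Gronwall on a compact interval in the ambient norm, where `f` is Lipschitz and `L` is bounded.
-/
lemma mild_unique [CompleteSpace X] (H : IsSemilinear L Q M γ ρ Γ f L₁ L₂ T)
    {y z : ℝ → X} {s t : ℝ} (hst : s ≤ t) (hz : IsMildOn L f z (Icc s t))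
    (hy : IsMildOn L f y (Icc s t)) (h : z s = y s) : z t = y t := by
  obtain ⟨B, hB0, hB⟩ := exists_bound_evolution H.evol s t
  obtain ⟨C, hC0, hC⟩ := H.exists_lipschitz
  obtain ⟨K₀, hK₀⟩ := isCompact_Icc.exists_bound_of_continuousOn (hz.cont.sub hy.cont)
  have hK₀' : 0 ≤ K₀ := (norm_nonneg _).trans (hK₀ s (left_mem_Icc.2 hst))
  -- The weight `e^{μ(r-s)}` makes the integral operator halve the constant; the `+ 1` keeps `μ`
  -- positive when `B = 0`.
  set μ := 2 * (B * C) + 1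
  have hμ : 0 < μ := by positivity
  have key := le_of_contracting (θ := 1 / 2) (x := ‖z t - y t‖) (m := 0)
    (w := Real.exp (μ * (t - s)))
    (C := fun K => ∀ r ∈ Icc s t, ‖z r - y r‖ ≤ K * Real.exp (μ * (r - s)))
    (by norm_num) (by norm_num) ?_ hK₀' ?_ ?_
  · simpa [sub_eq_zero] using key
  · intro K hK hr r hrs
    have hsub : Icc s r ⊆ Icc s t := Icc_subset_Icc_right hrs.2
    rw [H.mild_sub_eq hrs.1 (hz.mono hsub) (hy.mono hsub), h, sub_self, map_zero, zero_add]
    have h₁ : ‖∫ u in s..r, L r u (f u (z u) - f u (y u))‖ ≤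
        ∫ u in s..r, B * C * K * Real.exp (μ * (u - s)) := by
      refine intervalIntegral.norm_integral_le_of_norm_le hrs.1 (Eventually.of_forall fun u hu => ?_)
        (Continuous.intervalIntegrable (by fun_prop) _ _)
      have hu' : u ∈ Icc s t := ⟨hu.1.le, hu.2.trans hrs.2⟩
      calc ‖L r u (f u (z u) - f u (y u))‖ ≤ ‖L r u‖ * ‖f u (z u) - f u (y u)‖ :=
            (L r u).le_opNorm _
        _ ≤ B * (C * (K * Real.exp (μ * (u - s)))) := by
            gcongr
            · exact hB u r hu'.1 hu.2 hrs.2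
            · exact (hC u _ _).trans (by gcongr; exact hr u hu')
        _ = _ := by ring
    refine h₁.trans ?_
    have h₂ : ∫ u in s..r, Real.exp (μ * (u - s)) ≤ Real.exp (μ * (r - s)) / μ := by
      have := integral_exp_le (γ := 0) (ν := -μ) (by linarith) s r s
      simpa using this
    rw [intervalIntegral.integral_const_mul]
    calc B * C * K * _ ≤ B * C * K * (Real.exp (μ * (r - s)) / μ) := by gcongr
      _ = (B * C / μ) * (K * Real.exp (μ * (r - s))) := by ring
      _ ≤ 1 / 2 * (K * Real.exp (μ * (r - s))) := by
          gcongr ?_ * _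
          rw [div_le_iff₀ hμ]
          simp only [μ]
          linarith
      _ = _ := by ring
  · intro r hr
    refine (hK₀ r hr).trans (le_mul_of_one_le_right hK₀' (Real.one_le_exp ?_))
    have := hr.1
    have : 0 ≤ r - s := by linarith
    positivity
  · intro K hK hr
    simpa using hr t (right_mem_Icc.2 hst)

lemma isMildOn_zero (H : IsSemilinear L Q M γ ρ Γ f L₁ L₂ T) (I : Set ℝ) :
    IsMildOn L f (fun _ => 0) I :=
  ⟨continuousOn_const, fun _ _ _ _ _ => by simp [H.zero]⟩

lemma isGlobalSolution_zero [CompleteSpace X] (H : IsSemilinear L Q M γ ρ Γ f L₁ L₂ T) :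
    IsGlobalSolution T (fun _ => 0) := fun _ τ h =>
  H.mild_unique h ((H.isMildOn_process τ 0).mono Icc_subset_Ici_self) (H.isMildOn_zero _)
    (H.process.refl τ 0)

lemma hasBackwardGrowth_zero (H : IsSemilinear L Q M γ ρ Γ f L₁ L₂ T) (τ : ℝ) :
    HasBackwardGrowth Γ L Q γ ρ σ (fun _ => (0 : X)) τ :=
  hasBackwardGrowth_of_le (C := 0) fun r _ => by simpa using H.adaptedNorm_le_norm r (0 : X)

/-- Backward growth does not depend on the final time: on the compact interval between two times,
the adapted norm is dominated by a multiple of the continuous function `‖z r‖`. -/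
lemma hasBackwardGrowth_iff (H : IsSemilinear L Q M γ ρ Γ f L₁ L₂ T) {z : ℝ → X}
    (hz : Continuous z) {s t : ℝ} (hst : s ≤ t) :
    HasBackwardGrowth Γ L Q γ ρ σ z t ↔ HasBackwardGrowth Γ L Q γ ρ σ z s := by
  constructor
  · exact fun h => h.mono (image_mono (Iic_subset_Iic.2 hst))
  · intro h
    have h₁ : BddAbove ((fun r : ℝ => Real.exp (σ * r) * adaptedNorm Γ L Q γ ρ r (z r)) ''
        Icc s t) := by
      obtain ⟨C, hC⟩ := isCompact_Icc.exists_bound_of_continuousOn (s := Icc s t)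
        (f := fun r => Real.exp (σ * r) * (M * Γ (1, 1) * ‖z r‖)) (by fun_prop)
      refine ⟨C, ?_⟩
      rintro _ ⟨r, hr, rfl⟩
      refine le_trans ?_ ((le_abs_self _).trans (hC r hr))
      simp only
      gcongr
      exact H.adaptedNorm_le_norm r _
    have := BddAbove.union h h₁
    rwa [← image_union, Iic_union_Icc_eq_Iic hst] at this

end IsSemilinear

end Mild

end InvMan

namespace InvMan

open Set Filter Topology MeasureTheory

/-! ### The cone estimate -/

section Difference

variable {X : Type*} [NormedAddCommGroup X] [NormedSpace ℝ X]
  {L : ℝ → ℝ → X →L[ℝ] X} {Q : ℝ → X →L[ℝ] X} {M γ ρ : ℝ} {Γ : Seminorm ℝ (ℝ × ℝ)}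
  {f : ℝ → X → X} {L₁ L₂ : ℝ} {T : ℝ → ℝ → X → X} {σ κ : ℝ}

lemma integral_mul_linear_comb {w u v : ℝ → ℝ} (hw : Continuous w) (hu : Continuous u)
    (hv : Continuous v) (c d a b : ℝ) :
    ∫ s in a..b, w s * (c * u s + d * v s) =
      c * (∫ s in a..b, w s * u s) + d * ∫ s in a..b, w s * v s := by
  rw [← intervalIntegral.integral_const_mul, ← intervalIntegral.integral_const_mul,
    ← intervalIntegral.integral_add (Continuous.intervalIntegrable (by fun_prop) _ _)
      (Continuous.intervalIntegrable (by fun_prop) _ _)]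
  congr 1
  ext s
  ring

lemma tendsto_exp_mul_exp_atBot {γ ν : ℝ} (h : ν < γ) (t τ : ℝ) :
    Tendsto (fun s => Real.exp (-γ * (t - s)) * Real.exp (-ν * (s - τ))) atBot (𝓝 0) := by
  simp_rw [exp_mul_exp_eq]
  have h₁ : Tendsto (fun s : ℝ => (γ - ν) * s) atBot atBot :=
    tendsto_id.const_mul_atBot (sub_pos.2 h)
  simpa using (Real.tendsto_exp_atBot.comp h₁).const_mul (Real.exp (-γ * t + ν * τ))

namespace IsSemilinear

/-- Two mild solutions with controlled backward growth stay in the cone of slope `κ`. -/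
lemma cone_estimate [CompleteSpace X] (H : IsSemilinear L Q M γ ρ Γ f L₁ L₂ T)
    (hG : IsGap Γ γ ρ L₁ L₂ σ κ) {y z : ℝ → X} {τ : ℝ} (hz : IsMildOn L f z (Iic τ))
    (hy : IsMildOn L f y (Iic τ)) (hz' : HasBackwardGrowth Γ L Q γ ρ σ z τ)
    (hy' : HasBackwardGrowth Γ L Q γ ρ σ y τ) {t : ℝ} (ht : t ≤ τ) :
    unstableNorm L Q ρ t (z t - y t) ≤
        unstableNorm L Q ρ τ (z τ - y τ) * Real.exp (-(ρ + L₁ * Γ (1, κ)) * (t - τ)) ∧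
      stableNorm L Q γ t (z t - y t) ≤
        κ * unstableNorm L Q ρ τ (z τ - y τ) * Real.exp (-(ρ + L₁ * Γ (1, κ)) * (t - τ)) := by
  have hL₁ := H.pos₁
  have hL₂ := H.pos₂
  have hκ := hG.pos
  have hΓκ : 0 < Γ (1, κ) := H.admissible.pos_one κ
  have hσρ : 0 < σ - ρ := sub_pos.2 hG.lt_left
  have hγσ : 0 < γ - σ := sub_pos.2 hG.lt_right
  have hrate := hG.rate_lt
  have hslope := hG.slope_eq
  set ν := ρ + L₁ * Γ (1, κ) with hν
  have hρν : ρ < ν := by have := mul_pos hL₁ hΓκ; linarith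
  have hνγ : ν < γ := hrate.trans hG.lt_right
  set P := unstableNorm L Q ρ τ (z τ - y τ) with hP
  have hP0 : 0 ≤ P := unstableNorm_nonneg _ _
  set a := L₁ / (σ - ρ) with ha
  set b := L₂ / (γ - σ) with hb
  have ha0 : 0 < a := by positivity
  have hb0 : 0 < b := by positivity
  set θ := Γ (a, b)
  have hθ0 : 0 ≤ θ := apply_nonneg _ _
  -- The main terms are the ansatz of slope `κ` and rate `ν`; the error points in the direction `(a,
  -- b)`, whose `Γ`-norm is the contraction factor `θ`. One pass through the integral inequalities
  -- preserves the main terms and replaces `K` by `θ K`.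
  set C : ℝ → Prop := fun K => ∀ t ≤ τ,
    unstableNorm L Q ρ t (z t - y t) ≤
      P * Real.exp (-ν * (t - τ)) + K * (a * Real.exp (-σ * (t - τ))) ∧
    stableNorm L Q γ t (z t - y t) ≤
      κ * P * Real.exp (-ν * (t - τ)) + K * (b * Real.exp (-σ * (t - τ)))
  obtain ⟨Cz, hCz0, hCz⟩ := exists_growth_bound hz'
  obtain ⟨Cy, hCy0, hCy⟩ := exists_growth_bound hy'
  have hΓ₁ := H.admissible.pos_one_zero
  have hΓ₂ := H.admissible.pos_zero_one
  have hgrow : ∀ t ≤ τ, adaptedNorm Γ L Q γ ρ t (z t - y t) ≤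
      (Cz + Cy) * Real.exp (-σ * (t - τ)) := by
    intro t ht
    have h₁ : unstableNorm L Q ρ t (z t - y t) ≤
        unstableNorm L Q ρ t (z t) + unstableNorm L Q ρ t (y t) := by
      rw [sub_eq_add_neg, ← unstableNorm_neg H.splitting t (y t)]
      exact unstableNorm_add_le H.splitting _ _ _
    have h₂ : stableNorm L Q γ t (z t - y t) ≤
        stableNorm L Q γ t (z t) + stableNorm L Q γ t (y t) := by
      rw [sub_eq_add_neg, ← stableNorm_neg t (y t)]
      exact stableNorm_add_le H.splitting _ _ _
    refine (adaptedNorm_le H.admissible h₁ h₂).trans ((seminorm_add_le _ _ _ _).trans ?_)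
    rw [add_mul]
    exact add_le_add (hCz t ht) (hCy t ht)
  -- The growth hypothesis alone bounds both components by multiples of `e^{-σ(t-τ)}`, so the error
  -- term already suffices to start.
  have hinit : C ((Cz + Cy) / (Γ (1, 0) * a) + (Cz + Cy) / (Γ (0, 1) * b)) := by
    intro t ht
    have h₁ := (H.unstableNorm_le_adaptedNorm t (z t - y t)).trans (hgrow t ht)
    have h₂ := (H.stableNorm_le_adaptedNorm t (z t - y t)).trans (hgrow t ht)
    rw [← le_div_iff₀ hΓ₁] at h₁
    rw [← le_div_iff₀ hΓ₂] at h₂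
    have e₁ : (Cz + Cy) * Real.exp (-σ * (t - τ)) / Γ (1, 0) =
      (Cz + Cy) / (Γ (1, 0) * a) * (a * Real.exp (-σ * (t - τ))) := by field_simp
    have e₂ : (Cz + Cy) * Real.exp (-σ * (t - τ)) / Γ (0, 1) =
      (Cz + Cy) / (Γ (0, 1) * b) * (b * Real.exp (-σ * (t - τ))) := by field_simp
    rw [e₁] at h₁
    rw [e₂] at h₂
    constructor
    · refine h₁.trans (le_trans ?_ (le_add_of_nonneg_left (by positivity)))
      gcongr
      exact le_add_of_nonneg_right (by positivity)
    · refine h₂.trans (le_trans ?_ (le_add_of_nonneg_left (by positivity)))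
      gcongr
      exact le_add_of_nonneg_left (by positivity)
  have hstep : ∀ K, 0 ≤ K → C K → C (θ * K) := by
    intro K hK hC t ht
    have hψ : ∀ s ≤ τ, adaptedNorm Γ L Q γ ρ s (z s - y s) ≤
        Γ (1, κ) * P * Real.exp (-ν * (s - τ)) + θ * K * Real.exp (-σ * (s - τ)) := by
      intro s hs
      refine (adaptedNorm_le H.admissible (hC s hs).1 (hC s hs).2).trans
        ((seminorm_add_le _ _ _ _).trans (add_le_add (le_of_eq ?_) (le_of_eq ?_)))
      · have := seminorm_mul_mul (Γ := Γ) (mul_nonneg hP0 (Real.exp_pos (-ν * (s - τ))).le) 1 κ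
        rw [mul_one] at this
        rw [show κ * P * Real.exp (-ν * (s - τ)) = P * Real.exp (-ν * (s - τ)) * κ by ring, this]
        ring
      · have := seminorm_mul_mul (Γ := Γ) (mul_nonneg hK (Real.exp_pos (-σ * (s - τ))).le) a b
        rw [show K * (a * Real.exp (-σ * (s - τ))) = K * Real.exp (-σ * (s - τ)) * a by ring,
          show K * (b * Real.exp (-σ * (s - τ))) = K * Real.exp (-σ * (s - τ)) * b by ring, this]
        ring
    constructor
    · have h₁ := H.unstableNorm_mild_sub_le ht (hz.mono Icc_subset_Iic_self)
        (hy.mono Icc_subset_Iic_self) (by fun_prop) fun r hr => hψ r hr.2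
      rw [integral_mul_linear_comb (by fun_prop) (by fun_prop) (by fun_prop),
        integral_exp_backward hρν, integral_exp_backward hG.lt_left] at h₁
      refine h₁.trans ?_
      rw [← hP]
      have e₁ : ν - ρ = L₁ * Γ (1, κ) := by rw [hν]; ring
      rw [e₁]
      -- Because `ν - ρ = L₁ Γ (1, κ)`, the terms in `e^{-ρ(t-τ)} P` cancel and the main term
      -- reproduces itself exactly.
      have e₂ : Real.exp (-ρ * (t - τ)) * P + L₁ * (Γ (1, κ) * P *
          ((Real.exp (-ν * (t - τ)) - Real.exp (-ρ * (t - τ))) / (L₁ * Γ (1, κ))) +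
          θ * K * ((Real.exp (-σ * (t - τ)) - Real.exp (-ρ * (t - τ))) / (σ - ρ))) =
          P * Real.exp (-ν * (t - τ)) +
            θ * K * (a * (Real.exp (-σ * (t - τ)) - Real.exp (-ρ * (t - τ)))) := by
        rw [ha]
        field_simp
        ring
      rw [e₂]
      gcongr
      exact sub_le_self _ (Real.exp_pos _).le
    -- The stable part is started at `r → -∞`: its initial contribution grows at most like `e^{-σ
    -- r}` and is damped by `e^{-γ(t-r)}`, so it vanishes since `σ < γ`.
    · have hlim : Tendsto (fun r => (κ * P + K * b) *
          (Real.exp (-γ * (t - r)) * Real.exp (-σ * (r - τ))) +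
          (κ * P * Real.exp (-ν * (t - τ)) + θ * K * (b * Real.exp (-σ * (t - τ))))) atBot
          (𝓝 ((κ * P + K * b) * 0 +
            (κ * P * Real.exp (-ν * (t - τ)) + θ * K * (b * Real.exp (-σ * (t - τ)))))) :=
        ((tendsto_exp_mul_exp_atBot hG.lt_right t τ).const_mul _).add_const _
      rw [mul_zero, zero_add] at hlim
      refine ge_of_tendsto hlim ?_
      filter_upwards [eventually_le_atBot t] with r hr
      have hrτ : r ≤ τ := hr.trans ht
      have hsub : Icc r t ⊆ Iic τ := fun s hs => hs.2.trans ht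
      have h₁ := H.stableNorm_mild_sub_le hr (hz.mono hsub) (hy.mono hsub) (by fun_prop)
        fun s hs => hψ s (hsub hs)
      rw [integral_mul_linear_comb (by fun_prop) (by fun_prop) (by fun_prop)] at h₁
      refine h₁.trans (add_le_add ?_ ?_)
      · rw [mul_left_comm]
        gcongr
        refine (hC r hrτ).2.trans ?_
        have : Real.exp (-ν * (r - τ)) ≤ Real.exp (-σ * (r - τ)) := by
          apply Real.exp_le_exp.2
          nlinarith
        calc _ ≤ κ * P * Real.exp (-σ * (r - τ)) + K * (b * Real.exp (-σ * (r - τ))) := by gcongr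
          _ = _ := by ring
      · have i₁ := integral_exp_le hνγ r t τ
        have i₂ := integral_exp_le hG.lt_right r t τ
        have hγν : 0 < γ - ν := sub_pos.2 hνγ
        calc _ ≤ L₂ * (Γ (1, κ) * P * (Real.exp (-ν * (t - τ)) / (γ - ν)) +
              θ * K * (Real.exp (-σ * (t - τ)) / (γ - σ))) := by gcongr
          _ = L₂ * Γ (1, κ) * P * (Real.exp (-ν * (t - τ)) / (γ - ν)) +
              θ * K * (b * Real.exp (-σ * (t - τ))) := by rw [hb]; ring
          _ = _ := by
            rw [hslope]
            field_simp
  constructor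
  · exact le_of_contracting hθ0 hG.gap hstep (by positivity) hinit
      (w := a * Real.exp (-σ * (t - τ))) fun K _ hC => (hC t ht).1
  · exact le_of_contracting hθ0 hG.gap hstep (by positivity) hinit
      (w := b * Real.exp (-σ * (t - τ))) fun K _ hC => (hC t ht).2

end IsSemilinear

end Difference

end InvMan

namespace InvMan

open Set Filter Topology MeasureTheory
open scoped BoundedContinuousFunction

/-! ### The Lyapunov–Perron operator and existence of backward solutions -/

section LyapunovPerron

variable {X : Type*} [NormedAddCommGroup X] [NormedSpace ℝ X]
  {L : ℝ → ℝ → X →L[ℝ] X} {Q : ℝ → X →L[ℝ] X} {M γ ρ : ℝ} {Γ : Seminorm ℝ (ℝ × ℝ)}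
  {f : ℝ → X → X} {L₁ L₂ : ℝ} {T : ℝ → ℝ → X → X} {σ κ : ℝ}

lemma unstableNorm_smul_le (hQ : HasExponentialSplitting L Q M γ ρ) (τ : ℝ) {c : ℝ} (hc : 0 ≤ c)
    (x : X) : unstableNorm L Q ρ τ (c • x) ≤ c * unstableNorm L Q ρ τ x := by
  refine unstableNorm_le hQ fun t ht => ?_
  rw [map_smul, norm_smul, Real.norm_of_nonneg hc, mul_left_comm]
  exact mul_le_mul_of_nonneg_left (norm_unstableBack_le hQ ht x) hc

lemma stableNorm_smul_le (hQ : HasExponentialSplitting L Q M γ ρ) (τ : ℝ) {c : ℝ} (hc : 0 ≤ c)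
    (x : X) : stableNorm L Q γ τ (c • x) ≤ c * stableNorm L Q γ τ x := by
  refine stableNorm_le fun t ht => ?_
  rw [map_smul, ← smul_sub, map_smul, norm_smul, Real.norm_of_nonneg hc, mul_left_comm]
  exact mul_le_mul_of_nonneg_left (norm_stable_le hQ ht x) hc

lemma adaptedNorm_smul_le (hΓ : IsAdmissible Γ) (hQ : HasExponentialSplitting L Q M γ ρ) (τ : ℝ)
    {c : ℝ} (hc : 0 ≤ c) (x : X) :
    adaptedNorm Γ L Q γ ρ τ (c • x) ≤ c * adaptedNorm Γ L Q γ ρ τ x := by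
  refine (adaptedNorm_le hΓ (unstableNorm_smul_le hQ τ hc x)
    (stableNorm_smul_le hQ τ hc x)).trans_eq ?_
  rw [seminorm_mul_mul hc, adaptedNorm_eq]

/-- The stable convolution `∫_{-∞}^t L(t,s)(I-Q(s))g(s) ds`. -/
noncomputable def stableConvolution (L : ℝ → ℝ → X →L[ℝ] X) (Q : ℝ → X →L[ℝ] X) (g : ℝ → X)
    (t : ℝ) : X :=
  ∫ s in Iic t, (L t s (g s) - Q t (L t s (g s)))

/-- The Lyapunov–Perron operator with forcing `g`, based at time `τ` and point `ξ`. -/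
noncomputable def lyapunovPerron (L : ℝ → ℝ → X →L[ℝ] X) (Q : ℝ → X →L[ℝ] X) (τ : ℝ) (ξ : X)
    (g : ℝ → X) (t : ℝ) : X :=
  unstableBack L Q t τ (ξ - ∫ s in t..τ, L τ s (g s)) + stableConvolution L Q g t

lemma norm_stable_integrand_le (hQ : HasExponentialSplitting L Q M γ ρ) {g : ℝ → X} {C τ : ℝ}
    (hC : ∀ s, ‖g s‖ ≤ C * Real.exp (-σ * (s - τ))) {s t : ℝ} (hst : s ≤ t) :
    ‖L t s (g s) - Q t (L t s (g s))‖ ≤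
      M * C * (Real.exp (-γ * (t - s)) * Real.exp (-σ * (s - τ))) := by
  have hM := zero_le_bound hQ
  rw [proj_evolution hQ hst, ← map_sub]
  calc _ ≤ Real.exp (-γ * (t - s)) * (M * (C * Real.exp (-σ * (s - τ)))) := by
        refine (norm_stable_le hQ hst _).trans ?_
        gcongr
        exact (stableNorm_le_norm hQ _ _).trans (by gcongr; exact hC s)
    _ = _ := by ring

lemma integrableOn_stable_integrand [CompleteSpace X] (hL : IsLinearEvolutionProcess L)
    (hQ : HasExponentialSplitting L Q M γ ρ) (hσ : σ < γ) {g : ℝ → X} (hg : Continuous g)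
    {C τ : ℝ} (hC : ∀ s, ‖g s‖ ≤ C * Real.exp (-σ * (s - τ))) (t : ℝ) :
    IntegrableOn (fun s => L t s (g s) - Q t (L t s (g s))) (Iic t) := by
  have hc : ContinuousOn (fun s => L t s (g s)) (Iic t) :=
    continuousOn_evolution hL continuousOn_const continuousOn_id hg.continuousOn fun _ h => h
  refine Integrable.mono' ((integrableOn_exp_mul_exp hσ t τ t).const_mul (M * C))
    ((hc.sub ((Q t).continuous.comp_continuousOn hc)).aestronglyMeasurable measurableSet_Iic)
    ((ae_restrict_iff' measurableSet_Iic).2 (Eventually.of_forall fun s hs => ?_))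
  exact norm_stable_integrand_le hQ hC hs

/-- The substitution `s = t - u` fixes the domain of integration, after which dominated convergence
applies with an integrable bound `e^{-(γ-σ)u}`, locally uniform in `t`. -/
lemma continuous_stableConvolution [CompleteSpace X] (hL : IsLinearEvolutionProcess L)
    (hQ : HasExponentialSplitting L Q M γ ρ) (hσ : σ < γ) {g : ℝ → X} (hg : Continuous g)
    {C τ : ℝ} (hC0 : 0 ≤ C) (hC : ∀ s, ‖g s‖ ≤ C * Real.exp (-σ * (s - τ))) :
    Continuous (stableConvolution L Q g) := by
  have hM := zero_le_bound hQ
  have e : stableConvolution L Q g = fun t =>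
      ∫ u in Ici (0 : ℝ), (L t (t - u) (g (t - u)) - Q t (L t (t - u) (g (t - u)))) := by
    ext t
    rw [stableConvolution, ← integral_indicator measurableSet_Iic,
      ← integral_indicator measurableSet_Ici, ← integral_sub_left_eq_self _ volume t]
    congr 1
    ext u
    simp [indicator]
  -- `L t s` is meaningful only for `s ≤ t`; clipping with `min` gives an integrand continuous on
  -- the whole plane and unchanged for `u ≥ 0`.
  have hcont : Continuous fun p : ℝ × ℝ =>
      (L p.1 (min (p.1 - p.2) p.1) (g (p.1 - p.2)) -
        Q p.1 (L p.1 (min (p.1 - p.2) p.1) (g (p.1 - p.2)))) := by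
    rw [← continuousOn_univ]
    have : ContinuousOn (fun p : ℝ × ℝ => L p.1 (min (p.1 - p.2) p.1) (g (p.1 - p.2))) univ :=
      continuousOn_evolution hL (by fun_prop) (by fun_prop) (by fun_prop)
        fun p _ => min_le_right _ _
    exact this.sub (continuousOn_proj hL hQ (by fun_prop) this)
  have e' : stableConvolution L Q g = fun t =>
      ∫ u in Ici (0 : ℝ), (L t (min (t - u) t) (g (t - u)) -
        Q t (L t (min (t - u) t) (g (t - u)))) := by
    rw [e]
    ext t
    refine setIntegral_congr_fun measurableSet_Ici fun u (hu : 0 ≤ u) => ?_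
    simp only [min_eq_left (sub_le_self t hu)]
  rw [e', continuous_iff_continuousAt]
  intro t₀
  obtain ⟨B, hB⟩ := isCompact_Icc.exists_bound_of_continuousOn (s := Icc (t₀ - 1) (t₀ + 1))
    (f := fun t => Real.exp (-σ * (t - τ))) (by fun_prop)
  have hint : Integrable (fun u => M * C * B * Real.exp (-(γ - σ) * u))
      (volume.restrict (Ici 0)) := by
    refine Integrable.const_mul ?_ _
    exact (integrableOn_Ici_iff_integrableOn_Ioi).2
      (exp_neg_integrableOn_Ioi 0 (sub_pos.2 hσ))
  refine ContinuousOn.continuousAt (s := Icc (t₀ - 1) (t₀ + 1)) ?_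
    (Icc_mem_nhds (by linarith) (by linarith))
  refine continuousOn_of_dominated (fun t _ => ?_) (fun t ht => ?_) hint
    (Eventually.of_forall fun u => ?_)
  · exact (hcont.comp (Continuous.prodMk_right t)).aestronglyMeasurable
  · refine (ae_restrict_iff' measurableSet_Ici).2 (Eventually.of_forall fun u (hu : 0 ≤ u) => ?_)
    rw [min_eq_left (sub_le_self t hu)]
    refine (norm_stable_integrand_le hQ hC (sub_le_self t hu)).trans ?_
    have h₁ := (le_abs_self _).trans (hB t ht)
    rw [← Real.exp_add, show -γ * (t - (t - u)) + -σ * (t - u - τ) =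
      -σ * (t - τ) + -(γ - σ) * u by ring, Real.exp_add, mul_assoc (M * C) B]
    gcongr
  · exact (hcont.comp (Continuous.prodMk_left u)).continuousOn

lemma continuousOn_lyapunovPerron [CompleteSpace X] (hL : IsLinearEvolutionProcess L)
    (hQ : HasExponentialSplitting L Q M γ ρ) (hσ : σ < γ) {g : ℝ → X} (hg : Continuous g)
    {C τ : ℝ} (hC0 : 0 ≤ C) (hC : ∀ s, ‖g s‖ ≤ C * Real.exp (-σ * (s - τ))) (ξ : X) :
    ContinuousOn (lyapunovPerron L Q τ ξ g) (Iic τ) := by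
  refine ContinuousOn.add (continuousOn_unstableBack hL hQ (continuousOn_const.sub ?_))
    (continuous_stableConvolution hL hQ hσ hg hC0 hC).continuousOn
  have hc : Continuous fun s => L τ (min s τ) (g s) := by
    rw [← continuousOn_univ]
    exact continuousOn_evolution hL continuousOn_const (by fun_prop) hg.continuousOn
      fun _ _ => min_le_right _ _
  have hp : Continuous fun t => ∫ s in t..τ, L τ (min s τ) (g s) := by
    simp_rw [intervalIntegral.integral_symm τ]
    exact (intervalIntegral.continuous_primitive (fun a b => hc.intervalIntegrable a b) τ).neg
  refine hp.continuousOn.congr fun t (ht : t ≤ τ) => ?_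
  refine intervalIntegral.integral_congr fun s hs => ?_
  rw [uIcc_of_le ht] at hs
  simp only [min_eq_left hs.2]

/-- For every forcing `g` the operator solves the linear inhomogeneous equation; at a fixed point
`g` is the nonlinearity along the curve itself, which gives a mild solution. -/
lemma lyapunovPerron_eq_mild [CompleteSpace X] (hL : IsLinearEvolutionProcess L)
    (hQ : HasExponentialSplitting L Q M γ ρ) (hσ : σ < γ) {g : ℝ → X} (hg : Continuous g)
    {C τ : ℝ} (hC : ∀ s, ‖g s‖ ≤ C * Real.exp (-σ * (s - τ))) (ξ : X) {s t : ℝ}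
    (hst : s ≤ t) (ht : t ≤ τ) :
    lyapunovPerron L Q τ ξ g t =
      L t s (lyapunovPerron L Q τ ξ g s) + ∫ r in s..t, L t r (g r) := by
  have hi := integrableOn_stable_integrand hL hQ hσ hg hC
  have hts := intervalIntegrable_integrand hL hst hg.continuousOn
  have hτs := intervalIntegrable_integrand hL (hst.trans ht) hg.continuousOn
  have hτt := intervalIntegrable_integrand hL ht hg.continuousOn
  have hτst : IntervalIntegrable (fun r => L τ r (g r)) volume s t :=
    hτs.mono_set (by rw [uIcc_of_le hst, uIcc_of_le (hst.trans ht)]; exact Icc_subset_Icc_right ht)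
  -- unstable component
  have h₁ : unstableBack L Q t τ (∫ r in s..t, L τ r (g r)) = Q t (∫ r in s..t, L t r (g r)) := by
    have : ∫ r in s..t, L τ r (g r) = L τ t (∫ r in s..t, L t r (g r)) := by
      rw [← ContinuousLinearMap.intervalIntegral_comp_comm _ hts]
      refine intervalIntegral.integral_congr fun r hr => ?_
      rw [uIcc_of_le hst] at hr
      exact (evolution_comp hL hr.2 ht _).symm
    rw [this, unstableBack_evolution_self hL hQ ht]
  have h₂ : ∫ r in s..τ, L τ r (g r) =
      (∫ r in s..t, L τ r (g r)) + ∫ r in t..τ, L τ r (g r) :=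
    (intervalIntegral.integral_add_adjacent_intervals hτst hτt).symm
  -- stable component
  have h₃ : stableConvolution L Q g t = L t s (stableConvolution L Q g s) +
      ((∫ r in s..t, L t r (g r)) - Q t (∫ r in s..t, L t r (g r))) := by
    have e₁ : L t s (stableConvolution L Q g s) =
        ∫ r in Iic s, (L t r (g r) - Q t (L t r (g r))) := by
      rw [stableConvolution, ← ContinuousLinearMap.integral_comp_comm _ (hi s)]
      refine setIntegral_congr_fun measurableSet_Iic fun r (hr : r ≤ s) => ?_
      simp only [map_sub]
      rw [← proj_evolution hQ hst, evolution_comp hL hr hst]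
    have e₂ : (∫ r in s..t, L t r (g r)) - Q t (∫ r in s..t, L t r (g r)) =
        ∫ r in s..t, (L t r (g r) - Q t (L t r (g r))) := by
      have hcomp : IntervalIntegrable (fun r => Q t (L t r (g r))) volume s t := by
        refine ContinuousOn.intervalIntegrable ?_
        rw [uIcc_of_le hst]
        exact (Q t).continuous.comp_continuousOn (continuousOn_integrand hL hg.continuousOn)
      rw [intervalIntegral.integral_sub hts hcomp,
        ContinuousLinearMap.intervalIntegral_comp_comm _ hts]
    rw [e₁, e₂, stableConvolution, intervalIntegral.integral_of_le hst, ← Iic_union_Ioc_eq_Iic hst]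
    refine setIntegral_union ?_ measurableSet_Ioc ((hi t).mono_set (Iic_subset_Iic.2 hst))
      ((hi t).mono_set Ioc_subset_Iic_self)
    exact disjoint_left.2 fun r hr hr' => not_lt.2 hr hr'.1
  rw [lyapunovPerron, lyapunovPerron, h₃, map_add, evolution_unstableBack hL hQ hst ht, h₂]
  simp only [map_sub, map_add, h₁]
  abel

lemma unstableNorm_unstableBack_integral_le [CompleteSpace X] (hL : IsLinearEvolutionProcess L)
    (hQ : HasExponentialSplitting L Q M γ ρ) (hσ : ρ < σ) {g : ℝ → X} (hg : Continuous g)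
    {c t τ : ℝ} (hc : 0 ≤ c) (ht : t ≤ τ)
    (h : ∀ s ≤ τ, unstableNorm L Q ρ s (g s) ≤ c * Real.exp (-σ * (s - τ))) :
    unstableNorm L Q ρ t (unstableBack L Q t τ (∫ s in t..τ, L τ s (g s))) ≤
      c / (σ - ρ) * Real.exp (-σ * (t - τ)) := by
  have hσ' : 0 < σ - ρ := sub_pos.2 hσ
  refine (unstableNorm_integral_le hL hQ ht hg.continuousOn (by fun_prop)
    fun s hs => h s hs.2).trans ?_
  simp_rw [mul_left_comm _ c]
  rw [intervalIntegral.integral_const_mul, integral_exp_backward hσ, div_mul_eq_mul_div,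
    ← mul_div_assoc]
  gcongr
  exact sub_le_self _ (Real.exp_pos _).le

lemma stableNorm_stableConvolution_le [CompleteSpace X] (hL : IsLinearEvolutionProcess L)
    (hQ : HasExponentialSplitting L Q M γ ρ) (hσ : σ < γ) {g : ℝ → X}
    {c t τ : ℝ} (ht : t ≤ τ)
    (hi : IntegrableOn (fun s => L t s (g s) - Q t (L t s (g s))) (Iic t))
    (h : ∀ s ≤ τ, stableNorm L Q γ s (g s) ≤ c * Real.exp (-σ * (s - τ))) :
    stableNorm L Q γ t (stableConvolution L Q g t) ≤
      c / (γ - σ) * Real.exp (-σ * (t - τ)) := by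
  refine (stableNorm_integral_le (ψ := fun s => c * Real.exp (-σ * (s - τ))) hL hQ
    measurableSet_Iic subset_rfl hi ?_ fun s hs => h s (le_trans hs ht)).trans_eq ?_
  · simp_rw [mul_left_comm _ c]
    exact (integrableOn_exp_mul_exp hσ t τ t).const_mul c
  · simp_rw [mul_left_comm _ c]
    rw [integral_const_mul, setIntegral_exp_mul_exp hσ]
    ring

lemma proj_stableConvolution [CompleteSpace X]
    (hQ : HasExponentialSplitting L Q M γ ρ) {g : ℝ → X} {t : ℝ}
    (hi : IntegrableOn (fun s => L t s (g s) - Q t (L t s (g s))) (Iic t)) :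
    Q t (stableConvolution L Q g t) = 0 := by
  rw [stableConvolution, ← ContinuousLinearMap.integral_comp_comm _ hi]
  simp [proj_proj hQ]

lemma proj_lyapunovPerron [CompleteSpace X] (hQ : HasExponentialSplitting L Q M γ ρ) {g : ℝ → X}
    {t τ : ℝ} (ht : t ≤ τ) (ξ : X)
    (hi : IntegrableOn (fun s => L t s (g s) - Q t (L t s (g s))) (Iic t)) :
    Q t (lyapunovPerron L Q τ ξ g t) =
      unstableBack L Q t τ (ξ - ∫ s in t..τ, L τ s (g s)) := by
  rw [lyapunovPerron, map_add, proj_stableConvolution hQ hi, add_zero, proj_unstableBack hQ ht]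

/-- The term with `ξ` cancels, and the two convolutions gain the factors `1/(σ-ρ)` and `1/(γ-σ)`.
This is where the left-hand side of the gap condition comes from. -/
lemma adaptedNorm_lyapunovPerron_sub_le [CompleteSpace X] (hΓ : IsAdmissible Γ)
    (hL : IsLinearEvolutionProcess L) (hQ : HasExponentialSplitting L Q M γ ρ) (hσ : ρ < σ)
    (hσ' : σ < γ) {g h : ℝ → X} (hg : Continuous g) (hh : Continuous h) {C c₁ c₂ t τ : ℝ}
    (hgC : ∀ s, ‖g s‖ ≤ C * Real.exp (-σ * (s - τ)))
    (hhC : ∀ s, ‖h s‖ ≤ C * Real.exp (-σ * (s - τ))) (hc₁ : 0 ≤ c₁) (ht : t ≤ τ) (ξ : X)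
    (h₁ : ∀ s ≤ τ, unstableNorm L Q ρ s (g s - h s) ≤ c₁ * Real.exp (-σ * (s - τ)))
    (h₂ : ∀ s ≤ τ, stableNorm L Q γ s (g s - h s) ≤ c₂ * Real.exp (-σ * (s - τ))) :
    adaptedNorm Γ L Q γ ρ t (lyapunovPerron L Q τ ξ g t - lyapunovPerron L Q τ ξ h t) ≤
      Γ (c₁ / (σ - ρ) * Real.exp (-σ * (t - τ)), c₂ / (γ - σ) * Real.exp (-σ * (t - τ))) := by
  have hig := integrableOn_stable_integrand hL hQ hσ' hg hgC t
  have hih := integrableOn_stable_integrand hL hQ hσ' hh hhC t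
  have hi : IntegrableOn (fun s => L t s (g s - h s) - Q t (L t s (g s - h s))) (Iic t) := by
    refine (hig.sub hih).congr (Eventually.of_forall fun s => ?_)
    simp only [Pi.sub_apply, map_sub]
    abel
  have hconv : stableConvolution L Q (fun s => g s - h s) t =
      stableConvolution L Q g t - stableConvolution L Q h t := by
    rw [stableConvolution, stableConvolution, stableConvolution, ← integral_sub hig hih]
    congr 1
    ext s
    simp only [map_sub]
    abel
  refine adaptedNorm_le hΓ ?_ ?_
  · refine le_trans ?_ (unstableNorm_unstableBack_integral_le hL hQ hσ (hg.sub hh) hc₁ ht h₁)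
    rw [← unstableNorm_neg hQ]
    refine (unstableNorm_congr ?_).le
    rw [map_neg, map_sub, proj_lyapunovPerron hQ ht ξ hig, proj_lyapunovPerron hQ ht ξ hih,
      proj_unstableBack hQ ht]
    simp only [map_sub, Pi.sub_apply]
    rw [intervalIntegral.integral_sub (intervalIntegrable_integrand hL ht hg.continuousOn)
      (intervalIntegrable_integrand hL ht hh.continuousOn), map_sub]
    abel
  · refine le_trans ?_ (stableNorm_stableConvolution_le hL hQ hσ' ht hi h₂)
    refine (stableNorm_congr ?_).le
    rw [hconv, map_sub, map_sub, proj_lyapunovPerron hQ ht ξ hig, proj_lyapunovPerron hQ ht ξ hih,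
      proj_stableConvolution hQ hig, proj_stableConvolution hQ hih, lyapunovPerron, lyapunovPerron]
    abel

lemma exists_norm_lyapunovPerron_le [CompleteSpace X]
    (hL : IsLinearEvolutionProcess L) (hQ : HasExponentialSplitting L Q M γ ρ) (hσ : ρ < σ)
    (hσ' : σ < γ) {g : ℝ → X} (hg : Continuous g) {C τ : ℝ} (hC0 : 0 ≤ C)
    (hgC : ∀ s, ‖g s‖ ≤ C * Real.exp (-σ * (s - τ))) (ξ : X) :
    ∃ B, ∀ t ≤ τ, ‖lyapunovPerron L Q τ ξ g t‖ ≤ B * Real.exp (-σ * (t - τ)) := by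
  have hM := zero_le_bound hQ
  refine ⟨M * ‖ξ‖ + M * C / (σ - ρ) + M * C / (γ - σ), fun t ht => ?_⟩
  have hi := integrableOn_stable_integrand hL hQ hσ' hg hgC t
  rw [lyapunovPerron, map_sub]
  refine (norm_add_le _ _).trans ?_
  rw [add_mul]
  have hgM : ∀ s, M * ‖g s‖ ≤ M * C * Real.exp (-σ * (s - τ)) := fun s => by
    rw [mul_assoc]
    exact mul_le_mul_of_nonneg_left (hgC s) hM
  refine add_le_add ((norm_sub_le _ _).trans ?_) ?_
  · rw [add_mul]
    refine add_le_add ?_ ?_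
    · calc _ ≤ Real.exp (-ρ * (t - τ)) * (M * ‖ξ‖) :=
            (norm_unstableBack_le hQ ht ξ).trans (by gcongr; exact unstableNorm_le_norm hQ _ _)
        _ ≤ Real.exp (-σ * (t - τ)) * (M * ‖ξ‖) := by
            gcongr ?_ * _
            apply Real.exp_le_exp.2
            nlinarith
        _ = _ := mul_comm _ _
    · refine le_trans ?_ (unstableNorm_unstableBack_integral_le hL hQ hσ hg (by positivity) ht
        fun s _ => (unstableNorm_le_norm hQ s _).trans (hgM s))
      rw [← proj_unstableBack hQ ht, unstableNorm_proj hQ]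
      exact norm_proj_le_unstableNorm hL hQ _ _
  · refine le_trans ?_ (stableNorm_stableConvolution_le hL hQ hσ' ht hi
        fun s _ => (stableNorm_le_norm hQ s _).trans (hgM s))
    have := norm_sub_proj_le_stableNorm hL hQ t (stableConvolution L Q g t)
    rwa [proj_stableConvolution hQ hi, sub_zero] at this

namespace IsSemilinear

/-- Existence of mild solutions with controlled backward growth and prescribed unstable part. -/
lemma exists_mild_backward [CompleteSpace X] (H : IsSemilinear L Q M γ ρ Γ f L₁ L₂ T)
    (hG : IsGap Γ γ ρ L₁ L₂ σ κ) (τ : ℝ) (ξ : X) :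
    ∃ z : ℝ → X, IsMildOn L f z (Iic τ) ∧ HasBackwardGrowth Γ L Q γ ρ σ z τ ∧
      Q τ (z τ) = Q τ ξ := by
  obtain ⟨C, hC0, hC⟩ := H.exists_lipschitz
  obtain ⟨D, hD0, hD⟩ := H.exists_norm_le_adaptedNorm
  have hL₁ := H.pos₁
  have hL₂ := H.pos₂
  have hM := zero_le_bound H.splitting
  have hΓ₁ : 0 < Γ (1, 1) := H.admissible.pos_one 1
  -- Factoring out the weight moves the fixed point problem to the complete space of bounded
  -- continuous functions.
  set z : (ℝ →ᵇ X) → ℝ → X := fun v s => Real.exp (-σ * (s - τ)) • v s with hz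
  have hzc : ∀ v, Continuous (z v) := fun v => by have := v.continuous; fun_prop
  have hzn : ∀ v s, ‖z v s‖ ≤ ‖v‖ * Real.exp (-σ * (s - τ)) := fun v s => by
    rw [hz, norm_smul, Real.norm_of_nonneg (Real.exp_pos _).le, mul_comm]
    gcongr
    exact v.norm_coe_le_norm s
  set g : (ℝ →ᵇ X) → ℝ → X := fun v s => f s (z v s) with hg
  have hgc : ∀ v, Continuous (g v) := fun v => by
    have := H.continuousOn_nonlinearity (hzc v).continuousOn (I := univ)
    rwa [continuousOn_univ] at this
  have hgn : ∀ v s, ‖g v s‖ ≤ C * ‖v‖ * Real.exp (-σ * (s - τ)) := fun v s => by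
    have := hC s (z v s) 0
    rw [H.zero, sub_zero, sub_zero] at this
    rw [mul_assoc]
    exact this.trans (by gcongr; exact hzn v s)
  -- Beyond `τ` the image is frozen at its value at `τ`, so that functions on all of `ℝ` can be
  -- used; only `t ≤ τ` matters.
  have hP : ∀ v : ℝ →ᵇ X, ∃ w : ℝ →ᵇ X, ∀ t, w t = Real.exp (σ * (min t τ - τ)) •
      lyapunovPerron L Q τ ξ (g v) (min t τ) := by
    intro v
    obtain ⟨B, hB⟩ := exists_norm_lyapunovPerron_le H.evol H.splitting hG.lt_left hG.lt_right
      (hgc v) (by positivity) (hgn v) ξ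
    have hc := continuousOn_lyapunovPerron H.evol H.splitting hG.lt_right (hgc v) (by positivity)
      (hgn v) ξ
    have hc' : Continuous fun t => lyapunovPerron L Q τ ξ (g v) (min t τ) :=
      hc.comp_continuous (by fun_prop) fun t => min_le_right t τ
    refine ⟨BoundedContinuousFunction.ofNormedAddCommGroup (fun t =>
      Real.exp (σ * (min t τ - τ)) • lyapunovPerron L Q τ ξ (g v) (min t τ)) (by fun_prop) B
      fun t => ?_, fun t => rfl⟩
    rw [norm_smul, Real.norm_of_nonneg (Real.exp_pos _).le]
    calc _ ≤ Real.exp (σ * (min t τ - τ)) * (B * Real.exp (-σ * (min t τ - τ))) := by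
          gcongr; exact hB _ (min_le_right t τ)
      _ = B := by rw [mul_left_comm, ← Real.exp_add]; simp
  choose F hF using hP
  set θ := Γ (L₁ / (σ - ρ), L₂ / (γ - σ))
  have hθ0 : 0 ≤ θ := apply_nonneg _ _
  have hstep : ∀ (v w : ℝ →ᵇ X) (K : ℝ), 0 ≤ K →
      (∀ t ≤ τ, adaptedNorm Γ L Q γ ρ t (v t - w t) ≤ K) →
      ∀ t ≤ τ, adaptedNorm Γ L Q γ ρ t (F v t - F w t) ≤ θ * K := by
    intro v w K hK hvw t ht
    have hzz : ∀ s ≤ τ, adaptedNorm Γ L Q γ ρ s (z v s - z w s) ≤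
        K * Real.exp (-σ * (s - τ)) := fun s hs => by
      rw [hz, ← smul_sub, mul_comm K]
      refine (adaptedNorm_smul_le H.admissible H.splitting s (Real.exp_pos _).le _).trans ?_
      exact mul_le_mul_of_nonneg_left (hvw s hs) (Real.exp_pos _).le
    have hn : ∀ u ∈ ({v, w} : Set (ℝ →ᵇ X)), ∀ s, ‖g u s‖ ≤
        C * max ‖v‖ ‖w‖ * Real.exp (-σ * (s - τ)) := fun u hu s => by
      refine (hgn u s).trans ?_
      gcongr
      rcases hu with rfl | rfl
      exacts [le_max_left _ _, le_max_right _ _]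
    have key := adaptedNorm_lyapunovPerron_sub_le (c₁ := L₁ * K) (c₂ := L₂ * K) H.admissible H.evol
      H.splitting hG.lt_left hG.lt_right (hgc v) (hgc w) (hn v (by simp)) (hn w (by simp))
      (by positivity) ht ξ
      (fun s hs => (H.unstable_le s _ _).trans (by rw [mul_assoc]; gcongr; exact hzz s hs))
      (fun s hs => (H.stable_le s _ _).trans (by rw [mul_assoc]; gcongr; exact hzz s hs))
    rw [hF, hF, min_eq_left ht, ← smul_sub]
    refine (adaptedNorm_smul_le H.admissible H.splitting t (Real.exp_pos _).le _).trans ?_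
    have e := seminorm_mul_mul (Γ := Γ) (mul_nonneg hK (Real.exp_pos (-σ * (t - τ))).le)
      (L₁ / (σ - ρ)) (L₂ / (γ - σ))
    calc _ ≤ Real.exp (σ * (t - τ)) * _ := mul_le_mul_of_nonneg_left key (Real.exp_pos _).le
      _ = Real.exp (σ * (t - τ)) * (K * Real.exp (-σ * (t - τ)) * θ) := by
        rw [← e]
        congr 3 <;> ring
      _ = θ * K * (Real.exp (σ * (t - τ)) * Real.exp (-σ * (t - τ))) := by ring
      _ = θ * K := by rw [← Real.exp_add]; simp
  have hiter : ∀ (n : ℕ) (v w : ℝ →ᵇ X), ∀ t ≤ τ,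
      adaptedNorm Γ L Q γ ρ t (F^[n] v t - F^[n] w t) ≤ θ ^ n * (M * Γ (1, 1) * dist v w) := by
    intro n v w
    induction n with
    | zero =>
      intro t _
      rw [pow_zero, one_mul, dist_eq_norm]
      refine (H.adaptedNorm_le_norm t _).trans ?_
      gcongr
      exact (v - w).norm_coe_le_norm t
    | succ n ih =>
      rw [Function.iterate_succ_apply', Function.iterate_succ_apply', pow_succ', mul_assoc]
      exact hstep _ _ _ (by positivity) ih
  -- The contraction holds in the adapted norms, and returning to the supremum norm costs the factor
  -- `D M Γ (1, 1)`. Hence a high iterate of `F` is used. At least one application is needed so that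
  -- the values beyond `τ` are frozen.
  have hdist : ∀ (n : ℕ) (v w : ℝ →ᵇ X),
      dist (F^[n + 1] v) (F^[n + 1] w) ≤ θ ^ (n + 1) * (D * (M * Γ (1, 1))) * dist v w := by
    intro n v w
    refine (BoundedContinuousFunction.dist_le (by positivity)).2 fun t => ?_
    have hmin : ∀ (u : ℝ →ᵇ X), F^[n + 1] u t = F^[n + 1] u (min t τ) := fun u => by
      rw [Function.iterate_succ_apply', hF, hF, min_assoc, min_self]
    rw [hmin v, hmin w, dist_eq_norm]
    refine (hD (min t τ) _).trans ?_
    calc _ ≤ D * (θ ^ (n + 1) * (M * Γ (1, 1) * dist v w)) := by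
          gcongr
          exact hiter (n + 1) v w _ (min_le_right t τ)
      _ = _ := by ring
  obtain ⟨n, hn⟩ : ∃ n : ℕ, θ ^ (n + 1) * (D * (M * Γ (1, 1))) < 1 / 2 := by
    have h₁ : Tendsto (fun n : ℕ => θ ^ (n + 1) * (D * (M * Γ (1, 1)))) atTop
        (𝓝 (0 * (D * (M * Γ (1, 1))))) :=
      ((tendsto_pow_atTop_nhds_zero_of_lt_one hθ0 hG.gap).comp (tendsto_add_atTop_nat 1)).mul_const _
    rw [zero_mul] at h₁
    exact (h₁.eventually (gt_mem_nhds (by norm_num))).exists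
  have hcontr : ContractingWith (1 / 2) F^[n + 1] := by
    refine ⟨by rw [← NNReal.coe_lt_coe]; norm_num, LipschitzWith.of_dist_le_mul fun v w => ?_⟩
    refine (hdist n v w).trans ?_
    gcongr
    simpa using hn.le
  set v := ContractingWith.fixedPoint F^[n + 1] hcontr
  have hv : F v = v := hcontr.isFixedPt_fixedPoint_iterate
  have hzv : ∀ t ≤ τ, z v t = lyapunovPerron L Q τ ξ (g v) t := by
    intro t ht
    have h₁ := hF v t
    rw [hv, min_eq_left ht] at h₁
    rw [hz]
    simp only
    rw [h₁, smul_smul, ← Real.exp_add]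
    simp
  refine ⟨z v, ⟨(hzc v).continuousOn, fun s hs t ht hst => ?_⟩, ?_, ?_⟩
  · rw [hzv s hs, hzv t ht]
    exact lyapunovPerron_eq_mild H.evol H.splitting hG.lt_right (hgc v) (hgn v) ξ hst ht
  · refine hasBackwardGrowth_of_le (C := M * Γ (1, 1) * ‖v‖) fun r _ => ?_
    refine (H.adaptedNorm_le_norm r _).trans ?_
    rw [mul_assoc _ ‖v‖]
    gcongr
    exact hzn v r
  · rw [hzv τ le_rfl, proj_lyapunovPerron H.splitting le_rfl ξ
      (integrableOn_stable_integrand H.evol H.splitting hG.lt_right (hgc v) (hgn v) τ),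
      intervalIntegral.integral_same, sub_zero, unstableBack_self H.evol H.splitting]

end IsSemilinear

end LyapunovPerron

end InvMan

namespace InvMan

open Set Filter Topology MeasureTheory

/-! ### Global solutions and exponential attraction -/

section Attraction

variable {X : Type*} [NormedAddCommGroup X] [NormedSpace ℝ X]
  {L : ℝ → ℝ → X →L[ℝ] X} {Q : ℝ → X →L[ℝ] X} {M γ ρ : ℝ} {Γ : Seminorm ℝ (ℝ × ℝ)}
  {f : ℝ → X → X} {L₁ L₂ : ℝ} {T : ℝ → ℝ → X → X} {σ κ : ℝ}

lemma hasDerivAt_exp_mul_sub (γ t r : ℝ) {n : ℝ → ℝ} {n' : ℝ} (hn : HasDerivAt n n' r) :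
    HasDerivAt (fun r => Real.exp (-γ * (t - r)) * n r)
      (Real.exp (-γ * (t - r)) * (γ * n r + n')) r := by
  have h₁ : HasDerivAt (fun s => -γ * (t - s)) γ r := by
    simpa using ((hasDerivAt_id r).const_sub t).const_mul (-γ)
  exact (h₁.exp.mul hn).congr_deriv (by ring)

/-- The solution of the terminal value problem `n' = -ν n - c m`, `n(t) = 0`. -/
lemma exists_terminal_solution (ν c t : ℝ) {m : ℝ → ℝ} (hm : Continuous m) :
    ∃ n : ℝ → ℝ, n t = 0 ∧ ∀ r, HasDerivAt n (-ν * n r - c * m r) r := by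
  refine ⟨fun s => Real.exp (-ν * (s - 0)) * (c * ∫ r in s..t, Real.exp (ν * r) * m r), by simp,
    fun r => ?_⟩
  have hc : Continuous fun r => Real.exp (ν * r) * m r := by fun_prop
  have h₁ : HasDerivAt (fun s => ∫ r in s..t, Real.exp (ν * r) * m r)
      (-(Real.exp (ν * r) * m r)) r :=
    intervalIntegral.integral_hasDerivAt_left (hc.intervalIntegrable _ _)
      (hc.stronglyMeasurableAtFilter _ _) hc.continuousAt
  have h₂ : HasDerivAt (fun s => -ν * (s - 0)) (-ν) r := by
    simpa using ((hasDerivAt_id r).sub_const 0).const_mul (-ν)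
  refine (h₂.exp.mul (h₁.const_mul c)).congr_deriv ?_
  have : Real.exp (-ν * (r - 0)) * Real.exp (ν * r) = 1 := by rw [← Real.exp_add]; simp
  linear_combination (-c * m r) * this

namespace IsSemilinear

lemma exists_globalSolution [CompleteSpace X] (H : IsSemilinear L Q M γ ρ Γ f L₁ L₂ T)
    (hG : IsGap Γ γ ρ L₁ L₂ σ κ) (τ : ℝ) (ξ : X) :
    ∃ z : ℝ → X, IsGlobalSolution T z ∧ HasBackwardGrowth Γ L Q γ ρ σ z τ ∧
      Q τ (z τ) = Q τ ξ := by
  obtain ⟨z, hz, hz', hξ⟩ := H.exists_mild_backward hG τ ξ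
  have hT : ∀ s t, s ≤ t → t ≤ τ → T t s (z s) = z t := fun s t hst ht =>
    H.mild_unique hst ((H.isMildOn_process s (z s)).mono Icc_subset_Ici_self)
      (hz.mono (Icc_subset_Iic_self.trans (Iic_subset_Iic.2 ht))) (H.process.refl s _)
  refine ⟨fun t => if t ≤ τ then z t else T t τ (z τ), fun t s hst => ?_, ?_, by simpa using hξ⟩
  · simp only
    split_ifs with hs ht ht
    · exact hT s t hst ht
    · rw [← H.process.comp t τ s hs (not_le.1 ht).le, hT s τ hs le_rfl]
    · exact absurd (hst.trans ht) hs
    · exact H.process.comp t s τ (not_le.1 hs).le hst _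
  · obtain ⟨C, hC⟩ := hz'
    refine ⟨C, ?_⟩
    rintro _ ⟨r, hr, rfl⟩
    have hr' : r ≤ τ := hr
    simp only [if_pos hr']
    exact hC ⟨r, hr, rfl⟩

lemma cone_estimate_global [CompleteSpace X] (H : IsSemilinear L Q M γ ρ Γ f L₁ L₂ T)
    (hG : IsGap Γ γ ρ L₁ L₂ σ κ) {y z : ℝ → X} {τ : ℝ} (hz : IsGlobalSolution T z)
    (hy : IsGlobalSolution T y) (hz' : HasBackwardGrowth Γ L Q γ ρ σ z τ)
    (hy' : HasBackwardGrowth Γ L Q γ ρ σ y τ) :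
    stableNorm L Q γ τ (z τ - y τ) ≤ κ * unstableNorm L Q ρ τ (z τ - y τ) := by
  simpa using (H.cone_estimate hG ((H.isMildOn_globalSolution hz).mono (subset_univ _))
    ((H.isMildOn_globalSolution hy).mono (subset_univ _)) hz' hy' le_rfl).2

/-- Equal unstable parts at `τ` make the right-hand sides of the cone estimate zero at all earlier
times; afterwards the process determines the solution. -/
lemma globalSolution_unique [CompleteSpace X] (H : IsSemilinear L Q M γ ρ Γ f L₁ L₂ T)
    (hG : IsGap Γ γ ρ L₁ L₂ σ κ) {y z : ℝ → X} {τ : ℝ} (hz : IsGlobalSolution T z)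
    (hy : IsGlobalSolution T y) (hz' : HasBackwardGrowth Γ L Q γ ρ σ z τ)
    (hy' : HasBackwardGrowth Γ L Q γ ρ σ y τ) (h : Q τ (z τ) = Q τ (y τ)) : z = y := by
  have h0 : unstableNorm L Q ρ τ (z τ - y τ) = 0 := by
    have e : unstableNorm L Q ρ τ (z τ - y τ) = unstableNorm L Q ρ τ 0 :=
      unstableNorm_congr (by rw [map_sub, h, sub_self, map_zero])
    refine le_antisymm ?_ (unstableNorm_nonneg _ _)
    rw [e]
    simpa using unstableNorm_le_norm H.splitting τ (0 : X)
  have hle : ∀ t ≤ τ, z t = y t := by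
    intro t ht
    have h₁ := H.cone_estimate hG ((H.isMildOn_globalSolution hz).mono (subset_univ _))
      ((H.isMildOn_globalSolution hy).mono (subset_univ _)) hz' hy' ht
    rw [h0, mul_zero, zero_mul] at h₁
    have h₂ := norm_le_add H.evol H.splitting t (z t - y t)
    exact sub_eq_zero.1 (norm_le_zero_iff.1 (h₂.trans (by linarith [h₁.1, h₁.2])))
  ext t
  rcases le_total t τ with ht | ht
  · exact hle t ht
  · rw [← hz t τ ht, ← hy t τ ht, hle τ le_rfl]

/-- The attraction estimate in integral form: a majorant `m` of the deviation from the cone around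
`y` controls the stable component of `u - y` at time `t` if the unstable component vanishes. -/
lemma stableNorm_sub_le_of_majorant [CompleteSpace X] (H : IsSemilinear L Q M γ ρ Γ f L₁ L₂ T)
    (hG : IsGap Γ γ ρ L₁ L₂ σ κ) {u y : ℝ → X} {τ t d₀ : ℝ} (hτt : τ ≤ t)
    (hu : IsMildOn L f u (Icc τ t)) (hy : IsMildOn L f y (Icc τ t)) {m : ℝ → ℝ}
    (hm : Continuous m) (hm0 : ∀ s, 0 ≤ m s)
    (h0 : unstableNorm L Q ρ t (u t - y t) = 0)
    (hd₀ : stableNorm L Q γ τ (u τ - y τ) ≤ d₀ + κ * unstableNorm L Q ρ τ (u τ - y τ))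
    (h : ∀ s ∈ Icc τ t,
      stableNorm L Q γ s (u s - y s) ≤ m s + κ * unstableNorm L Q ρ s (u s - y s)) :
    stableNorm L Q γ t (u t - y t) ≤ Real.exp (-γ * (t - τ)) * d₀ +
      (L₂ + κ * L₁) * Γ (0, 1) * ∫ s in τ..t, Real.exp (-γ * (t - s)) * m s := by
  have hL₁ := H.pos₁
  have hL₂ := H.pos₂
  have hM := zero_le_bound H.splitting
  have hκ := hG.pos
  have hΓκ : 0 < Γ (1, κ) := H.admissible.pos_one κ
  have hslope := hG.slope_eq
  -- `n` solves with equality the backward inequality for the unstable norm `p` that results from `Γ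
  -- (p, m + κ p) ≤ Γ (0, 1) m + Γ (1, κ) p`.
  obtain ⟨n, hnt, hn⟩ := exists_terminal_solution (ρ + L₁ * Γ (1, κ)) (L₁ * Γ (0, 1)) t hm
  have hnc : Continuous n := continuous_iff_continuousAt.2 fun r => (hn r).continuousAt
  have hA : ∀ s, L₁ * ∫ r in s..t, Real.exp (-ρ * (s - r)) * (Γ (0, 1) * m r + Γ (1, κ) * n r) =
      n s := by
    intro s
    rw [← intervalIntegral.integral_const_mul,
      intervalIntegral.integral_eq_sub_of_hasDerivAt
        (f := fun r => -(Real.exp (-ρ * (s - r)) * n r))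
        (fun r _ => (hasDerivAt_exp_mul_sub ρ s r (hn r)).neg.congr_deriv (by ring))
        (Continuous.intervalIntegrable (by fun_prop) _ _), hnt]
    simp
  -- By the slope equation the `n` term is the derivative of `κ e^{-γ(t-r)} n`, up to a multiple of
  -- `m`. The boundary term at `τ` cancels the contribution `κ n τ` of the initial value in the
  -- final estimate.
  have hB : L₂ * ∫ r in τ..t, Real.exp (-γ * (t - r)) * (Γ (0, 1) * m r + Γ (1, κ) * n r) =
      -(κ * (Real.exp (-γ * (t - τ)) * n τ)) +
        (L₂ + κ * L₁) * Γ (0, 1) * ∫ s in τ..t, Real.exp (-γ * (t - s)) * m s := by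
    have e : ∫ r in τ..t, (L₂ * (Real.exp (-γ * (t - r)) * (Γ (0, 1) * m r + Γ (1, κ) * n r)) -
        (L₂ + κ * L₁) * Γ (0, 1) * (Real.exp (-γ * (t - r)) * m r)) =
        -(κ * (Real.exp (-γ * (t - τ)) * n τ)) := by
      rw [intervalIntegral.integral_eq_sub_of_hasDerivAt
        (f := fun r => κ * (Real.exp (-γ * (t - r)) * n r))
        (fun r _ => ((hasDerivAt_exp_mul_sub γ t r (hn r)).const_mul κ).congr_deriv
          (by linear_combination (-Real.exp (-γ * (t - r)) * n r) * hslope))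
        (Continuous.intervalIntegrable (by fun_prop) _ _), hnt]
      simp
    rw [intervalIntegral.integral_sub (Continuous.intervalIntegrable (by fun_prop) _ _)
      (Continuous.intervalIntegrable (by fun_prop) _ _), intervalIntegral.integral_const_mul,
      intervalIntegral.integral_const_mul] at e
    linarith
  have hψ : ∀ v : ℝ → ℝ, (∀ s ∈ Icc τ t, unstableNorm L Q ρ s (u s - y s) ≤ v s) →
      ∀ s ∈ Icc τ t, adaptedNorm Γ L Q γ ρ s (u s - y s) ≤ Γ (0, 1) * m s + Γ (1, κ) * v s := by
    intro v hv s hs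
    have hv0 : 0 ≤ v s := (unstableNorm_nonneg _ _).trans (hv s hs)
    have h₁ : stableNorm L Q γ s (u s - y s) ≤ m s + v s * κ := by
      refine (h s hs).trans ?_
      rw [mul_comm (v s)]
      gcongr
      exact hv s hs
    refine (adaptedNorm_le H.admissible (hv s hs) h₁).trans ?_
    have e₁ := seminorm_mul_mul (Γ := Γ) hv0 1 κ
    have e₂ := seminorm_mul_mul (Γ := Γ) (hm0 s) 0 1
    rw [mul_one] at e₁ e₂
    rw [mul_zero] at e₂
    have e₃ := seminorm_add_le (Γ := Γ) 0 (m s) (v s) (v s * κ)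
    rw [zero_add] at e₃
    linarith
  have hp : ∀ s ∈ Icc τ t, unstableNorm L Q ρ s (u s - y s) ≤ n s := by
    -- Comparison of the unstable norm with `n`: the rate is chosen so that `L₁ Γ (1, κ)/(μ - ρ) =
    -- 1/2`.
    set μ := ρ + 2 * (L₁ * Γ (1, κ)) with hμ
    have hρμ : ρ < μ := by have := mul_pos hL₁ hΓκ; linarith
    have hcd := hu.cont.sub hy.cont
    obtain ⟨K₀, hK₀⟩ := isCompact_Icc.exists_bound_of_continuousOn (s := Icc τ t)
      (f := fun s => (M * ‖u s - y s‖ - n s) * Real.exp (μ * (s - t)))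
      (((continuousOn_const.mul hcd.norm).sub hnc.continuousOn).mul (by fun_prop))
    intro s hs
    refine le_of_contracting (θ := 1 / 2) (w := Real.exp (-μ * (s - t)))
      (C := fun K => ∀ s ∈ Icc τ t,
        unstableNorm L Q ρ s (u s - y s) ≤ n s + K * Real.exp (-μ * (s - t)))
      (by norm_num) (by norm_num) ?_ ((norm_nonneg _).trans (hK₀ s hs)) ?_ fun K _ hC => hC s hs
    · intro K hK hC s hs
      have hsub : Icc s t ⊆ Icc τ t := Icc_subset_Icc_left hs.1
      have h₁ := H.unstableNorm_mild_sub_le hs.2 (hu.mono hsub) (hy.mono hsub) (by fun_prop)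
        fun r hr => (hψ _ hC r (hsub hr)).trans_eq (show _ = 1 * (Γ (0, 1) * m r + Γ (1, κ) * n r) +
          Γ (1, κ) * K * Real.exp (-μ * (r - t)) by ring)
      rw [h0, mul_zero, zero_add,
        integral_mul_linear_comb (by fun_prop) (by fun_prop) (by fun_prop), one_mul, mul_add, hA,
        integral_exp_backward hρμ] at h₁
      refine h₁.trans (add_le_add_right ?_ _)
      have e₁ : μ - ρ = 2 * (L₁ * Γ (1, κ)) := by rw [hμ]; ring
      have e₂ : L₁ * (Γ (1, κ) * K * ((Real.exp (-μ * (s - t)) - Real.exp (-ρ * (s - t))) /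
          (2 * (L₁ * Γ (1, κ))))) =
          1 / 2 * K * (Real.exp (-μ * (s - t)) - Real.exp (-ρ * (s - t))) := by field_simp
      rw [e₁, e₂]
      gcongr
      exact sub_le_self _ (Real.exp_pos _).le
    · intro s hs
      have h₁ := (le_abs_self _).trans (hK₀ s hs)
      have h₂ := unstableNorm_le_norm H.splitting s (u s - y s)
      rw [← le_div_iff₀ (Real.exp_pos _), div_eq_mul_inv, ← Real.exp_neg, ← neg_mul] at h₁
      linarith
  have hτ : τ ∈ Icc τ t := left_mem_Icc.2 hτt
  have h₁ := H.stableNorm_mild_sub_le hτt hu hy (by fun_prop) (hψ n hp)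
  rw [hB] at h₁
  have h₂ : Real.exp (-γ * (t - τ)) * stableNorm L Q γ τ (u τ - y τ) ≤
      Real.exp (-γ * (t - τ)) * (d₀ + κ * n τ) := by
    gcongr
    exact hd₀.trans (by gcongr; exact hp τ hτ)
  linarith

/-- Exponential attraction of the forward solution `u` by the solutions `Z s` that share its
unstable component at time `s`. -/
lemma stableNorm_sub_le_exp [CompleteSpace X] (H : IsSemilinear L Q M γ ρ Γ f L₁ L₂ T)
    (hG : IsGap Γ γ ρ L₁ L₂ σ κ) {u : ℝ → X} {Z : ℝ → ℝ → X} {τ t : ℝ} (hτt : τ ≤ t)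
    (hu : IsMildOn L f u (Icc τ t)) (hZ : ∀ s, IsGlobalSolution T (Z s))
    (hZ' : ∀ s, HasBackwardGrowth Γ L Q γ ρ σ (Z s) s) (hZQ : ∀ s, Q s (Z s s) = Q s (u s)) :
    stableNorm L Q γ t (u t - Z t t) ≤ stableNorm L Q γ τ (u τ - Z τ τ) *
      Real.exp (-(γ - (L₂ + κ * L₁) * Γ (0, 1)) * (t - τ)) := by
  have hL₁ := H.pos₁
  have hL₂ := H.pos₂
  have hM := zero_le_bound H.splitting
  have hκ := hG.pos
  have hc : 0 < (L₂ + κ * L₁) * Γ (0, 1) :=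
    mul_pos (by positivity) H.admissible.pos_zero_one
  set c := (L₂ + κ * L₁) * Γ (0, 1)
  set D := stableNorm L Q γ τ (u τ - Z τ τ) with hD
  have hD0 : 0 ≤ D := stableNorm_nonneg _ _
  have hmild : ∀ s, IsMildOn L f (Z s) univ := fun s => H.isMildOn_globalSolution (hZ s)
  -- Insert `Z r r`: the two manifold points `Z r r` and `Z s r` lie in a common cone, and `Z r r`
  -- has the unstable part of `u r`.
  have hcone : ∀ r s, r ≤ s → stableNorm L Q γ r (u r - Z s r) ≤
      stableNorm L Q γ r (u r - Z r r) + κ * unstableNorm L Q ρ r (u r - Z s r) := by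
    intro r s hrs
    have hg := (H.hasBackwardGrowth_iff (continuousOn_univ.1 (hmild s).cont) hrs).1 (hZ' s)
    have h₁ := H.cone_estimate_global hG (hZ r) (hZ s) (hZ' r) hg
    rw [unstableNorm_congr (y := u r - Z s r) (by rw [map_sub, map_sub, hZQ])] at h₁
    rw [← sub_add_sub_cancel (u r) (Z r r) (Z s r)]
    refine (stableNorm_add_le H.splitting _ _ _).trans (add_le_add_right ?_ _)
    rwa [sub_add_sub_cancel]
  have h0 : ∀ s, unstableNorm L Q ρ s (u s - Z s s) = 0 := by
    intro s
    refine le_antisymm ?_ (unstableNorm_nonneg _ _)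
    rw [unstableNorm_congr (y := 0) (by rw [map_sub, hZQ, sub_self, map_zero])]
    simpa using unstableNorm_le_norm H.splitting s (0 : X)
  obtain ⟨K₀, hK₀⟩ := isCompact_Icc.exists_bound_of_continuousOn (s := Icc τ t)
      (f := fun s => (M * ‖u s‖ + κ * (M * ‖u s‖)) * Real.exp ((γ - 2 * c) * (s - τ)))
      (((continuousOn_const.mul hu.cont.norm).add
        (continuousOn_const.mul (continuousOn_const.mul hu.cont.norm))).mul (by fun_prop))
  -- The term of rate `γ - c` reproduces itself under the Gronwall inequality; for rate `γ - 2c` the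
  -- integral contributes `c/(2c) = 1/2`.
  refine le_of_contracting (θ := 1 / 2) (w := Real.exp (-(γ - 2 * c) * (t - τ)))
      (C := fun K => ∀ s ∈ Icc τ t, stableNorm L Q γ s (u s - Z s s) ≤
        D * Real.exp (-(γ - c) * (s - τ)) + K * Real.exp (-(γ - 2 * c) * (s - τ)))
      (by norm_num) (by norm_num) ?_ ((norm_nonneg _).trans (hK₀ τ (left_mem_Icc.2 hτt))) ?_
      fun K _ hC => hC t (right_mem_Icc.2 hτt)
  · intro K hK hC s hs
    have hsub : Icc τ s ⊆ Icc τ t := Icc_subset_Icc_right hs.2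
    have h₁ := H.stableNorm_sub_le_of_majorant hG (y := Z s) (d₀ := D) hs.1 (hu.mono hsub)
      ((hmild s).mono (subset_univ _))
      (m := fun s => D * Real.exp (-(γ - c) * (s - τ)) + K * Real.exp (-(γ - 2 * c) * (s - τ)))
      (by fun_prop) (fun s => by positivity) (h0 s) (hcone τ s hs.1)
      fun r hr => (hcone r s hr.2).trans (add_le_add_left (hC r (hsub hr)) _)
    rw [integral_mul_linear_comb (by fun_prop) (by fun_prop) (by fun_prop),
      integral_exp_forward (by linarith), integral_exp_forward (by linarith)] at h₁
    refine h₁.trans ?_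
    have e : Real.exp (-γ * (s - τ)) * D + c *
        (D * ((Real.exp (-(γ - c) * (s - τ)) - Real.exp (-γ * (s - τ))) / (γ - (γ - c))) +
        K * ((Real.exp (-(γ - 2 * c) * (s - τ)) - Real.exp (-γ * (s - τ))) /
          (γ - (γ - 2 * c)))) =
        D * Real.exp (-(γ - c) * (s - τ)) + 1 / 2 * K *
          (Real.exp (-(γ - 2 * c) * (s - τ)) - Real.exp (-γ * (s - τ))) := by
      rw [sub_sub_cancel, sub_sub_cancel]
      field_simp
      ring
    rw [e]
    gcongr
    exact sub_le_self _ (Real.exp_pos _).le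
  · intro s hs
    have h₁ := (le_abs_self _).trans (hK₀ s hs)
    rw [← le_div_iff₀ (Real.exp_pos _), div_eq_mul_inv, ← Real.exp_neg, ← neg_mul] at h₁
    have h₂ : stableNorm L Q γ s (u s - Z s s) ≤ M * ‖u s‖ + κ * (M * ‖u s‖) := by
      have h₃ := H.cone_estimate_global hG (hZ s) H.isGlobalSolution_zero (hZ' s)
        (H.hasBackwardGrowth_zero s)
      rw [sub_zero, unstableNorm_congr (hZQ s)] at h₃
      rw [sub_eq_add_neg]
      refine (stableNorm_add_le H.splitting _ _ _).trans
        (add_le_add (stableNorm_le_norm H.splitting _ _) ?_)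
      rw [stableNorm_neg]
      refine h₃.trans ?_
      gcongr
      exact unstableNorm_le_norm H.splitting _ _
    have : 0 ≤ D * Real.exp (-(γ - c) * (s - τ)) := by positivity
    linarith

end IsSemilinear

end Attraction

end InvMan

namespace InvMan

open Set Filter Topology MeasureTheory

lemma semiDist_image_le {X : Type*} [NormedAddCommGroup X] {A B : Set X} {S : X → X} {r : ℝ}
    (h : ∀ x ∈ A, ∃ y ∈ B, ‖S x - y‖ ≤ r) : semiDist (S '' A) B ≤ ENNReal.ofReal r := by
  refine iSup₂_le ?_
  rintro _ ⟨x, hx, rfl⟩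
  obtain ⟨y, hy, hxy⟩ := h x hx
  refine (Metric.infEDist_le_edist_of_mem hy).trans ?_
  rw [edist_dist, dist_eq_norm]
  exact ENNReal.ofReal_le_ofReal hxy

/-! ### Invariance, uniqueness and rates on the manifold -/

section Manifold

variable {X : Type*} [NormedAddCommGroup X] [NormedSpace ℝ X]
  {L : ℝ → ℝ → X →L[ℝ] X} {Q : ℝ → X →L[ℝ] X} {M γ ρ : ℝ} {Γ : Seminorm ℝ (ℝ × ℝ)}
  {f : ℝ → X → X} {L₁ L₂ : ℝ} {T : ℝ → ℝ → X → X} {σ κ : ℝ}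

namespace IsSemilinear

lemma mem_manifoldM_of_globalSolution (H : IsSemilinear L Q M γ ρ Γ f L₁ L₂ T)
    {z : ℝ → X} {τ : ℝ} (hz : IsGlobalSolution T z) (hz' : HasBackwardGrowth Γ L Q γ ρ σ z τ)
    (t : ℝ) : z t ∈ manifoldM Γ L Q T γ ρ σ t := by
  have hc := continuousOn_univ.1 (H.isMildOn_globalSolution hz).cont
  refine ⟨z, hz, rfl, ?_⟩
  rcases le_total t τ with h | h
  · exact (H.hasBackwardGrowth_iff hc h).1 hz'
  · exact (H.hasBackwardGrowth_iff hc h).2 hz'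

lemma manifoldM_invariant (H : IsSemilinear L Q M γ ρ Γ f L₁ L₂ T) {t τ : ℝ} (h : τ ≤ t) :
    T t τ '' manifoldM Γ L Q T γ ρ σ τ = manifoldM Γ L Q T γ ρ σ t := by
  ext η
  constructor
  · rintro ⟨_, ⟨z, hz, rfl, hz'⟩, rfl⟩
    rw [hz t τ h]
    exact H.mem_manifoldM_of_globalSolution hz hz' t
  · rintro ⟨z, hz, rfl, hz'⟩
    exact ⟨z τ, H.mem_manifoldM_of_globalSolution hz hz' τ, hz t τ h⟩

/-- Membership of `w t` only provides some solution `y` through `w t` with backward growth. Flowing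
forward, `y` meets `z` at `τ`, so `y = z` by uniqueness; this is applied at every `t ≤ τ`. -/
lemma globalSolution_unique_of_mem [CompleteSpace X] (H : IsSemilinear L Q M γ ρ Γ f L₁ L₂ T)
    (hG : IsGap Γ γ ρ L₁ L₂ σ κ) {w z : ℝ → X} {τ : ℝ} (hz : IsGlobalSolution T z)
    (hz' : HasBackwardGrowth Γ L Q γ ρ σ z τ) (hw : IsGlobalSolution T w) (hwz : w τ = z τ)
    (hwM : ∀ t, w t ∈ manifoldM Γ L Q T γ ρ σ t) : w = z := by
  have hle : ∀ t ≤ τ, w t = z t := by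
    intro t ht
    obtain ⟨y, hy, hyt, hy'⟩ := hwM t
    have hyc := continuousOn_univ.1 (H.isMildOn_globalSolution hy).cont
    have hyτ : y τ = z τ := by rw [← hy τ t ht, hyt, hw τ t ht, hwz]
    have := H.globalSolution_unique hG hy hz ((H.hasBackwardGrowth_iff hyc ht).2 hy') hz'
      (by rw [hyτ])
    rw [← hyt, this]
  ext t
  rcases le_total t τ with ht | ht
  · exact hle t ht
  · rw [← hw t τ ht, ← hz t τ ht, hwz]

lemma adaptedNorm_backward_le [CompleteSpace X] (H : IsSemilinear L Q M γ ρ Γ f L₁ L₂ T)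
    (hG : IsGap Γ γ ρ L₁ L₂ σ κ) {z : ℝ → X} {t τ : ℝ} (hz : IsGlobalSolution T z)
    (hz' : HasBackwardGrowth Γ L Q γ ρ σ z τ) (ht : t ≤ τ) :
    adaptedNorm Γ L Q γ ρ t (z t) ≤ Γ (1, κ) / Γ (1, 0) *
      Real.exp (-(ρ + L₁ * Γ (1, κ)) * (t - τ)) * adaptedNorm Γ L Q γ ρ τ (z τ) := by
  have hκ := hG.pos
  have hΓ₁ := H.admissible.pos_one_zero
  have h := H.cone_estimate hG ((H.isMildOn_globalSolution hz).mono (subset_univ _))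
    (H.isMildOn_zero _) hz' (H.hasBackwardGrowth_zero τ) ht
  rw [sub_zero, sub_zero] at h
  set E := Real.exp (-(ρ + L₁ * Γ (1, κ)) * (t - τ))
  set P := unstableNorm L Q ρ τ (z τ)
  have hP0 : 0 ≤ P := unstableNorm_nonneg _ _
  have hE0 : 0 ≤ E := (Real.exp_pos _).le
  have hP : P ≤ adaptedNorm Γ L Q γ ρ τ (z τ) / Γ (1, 0) :=
    (le_div_iff₀ hΓ₁).2 (H.unstableNorm_le_adaptedNorm τ (z τ))
  have e := seminorm_mul_mul (Γ := Γ) (mul_nonneg hP0 hE0) 1 κ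
  rw [mul_one, show P * E * κ = κ * P * E by ring] at e
  calc _ ≤ Γ (P * E, κ * P * E) := adaptedNorm_le H.admissible h.1 h.2
    _ = P * (E * Γ (1, κ)) := by rw [e]; ring
    _ ≤ adaptedNorm Γ L Q γ ρ τ (z τ) / Γ (1, 0) * (E * Γ (1, κ)) := by gcongr
    _ = _ := by ring

end IsSemilinear

lemma IsGap.exponent_eq (hG : IsGap Γ γ ρ L₁ L₂ σ κ) :
    γ - (γ - ρ) * L₂ * Γ (0, 1) / (γ - ρ - L₁ * Γ (1, κ)) =
      γ - (L₂ + κ * L₁) * Γ (0, 1) := by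
  have h₁ := hG.slope_eq
  have h₂ : 0 < γ - ρ - L₁ * Γ (1, κ) := by linarith [hG.rate_lt, hG.lt_right]
  rw [sub_right_inj, div_eq_iff h₂.ne']
  linear_combination L₁ * Γ (0, 1) * h₁

end Manifold

end InvMan

/-! ### Assembly of the main theorem -/

theorem theorem3p1 {X : Type*} [NormedAddCommGroup X] [NormedSpace ℝ X] [CompleteSpace X]
    -- the linear process and its exponential splitting
    (L : ℝ → ℝ → X →L[ℝ] X) (hL : IsLinearEvolutionProcess L)
    (Q : ℝ → X →L[ℝ] X) (M γ ρ : ℝ) (hQ : HasExponentialSplitting L Q M γ ρ)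
    -- the admissible norm
    (Γ : Seminorm ℝ (ℝ × ℝ)) (hΓ : IsAdmissible Γ)
    -- the nonlinearity
    (f : ℝ → X → X) (hf : Continuous (Function.uncurry f)) (hf0 : ∀ t : ℝ, f t 0 = 0)
    (L₁ L₂ : ℝ) (hL₁ : 0 < L₁) (hL₂ : 0 < L₂)
    (hfN : ∀ (t : ℝ) (u v : X),
      normN L Q ρ t (Q t (f t u - f t v)) ≤ L₁ * adaptedNorm Γ L Q γ ρ t (u - v))
    (hfS : ∀ (t : ℝ) (u v : X),
      normS L γ t ((f t u - f t v) - Q t (f t u - f t v))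
        ≤ L₂ * adaptedNorm Γ L Q γ ρ t (u - v))
    -- the nonlinear process and the variation of constants formula
    (T : ℝ → ℝ → X → X) (hT : IsEvolutionProcess T)
    (hVCF : ∀ (t τ : ℝ), τ ≤ t → ∀ η : X,
      T t τ η = L t τ η + ∫ s in τ..t, L t s (f s (T s τ η)))
    -- the gap condition
    (σ : ℝ) (hσ : σ ∈ Set.Ioo ρ γ) (hgap : Γ (L₁ / (σ - ρ), L₂ / (γ - σ)) < 1) :
    IsInvariantManifold Q T (manifoldM Γ L Q T γ ρ σ) ∧
    ∃ κ : ℝ, IsLeast (kappaRoots Γ γ ρ L₁ L₂) κ ∧ κ < L₂ / L₁ * ((σ - ρ) / (γ - σ)) ∧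
    ∃ Sig : ℝ → X → X,
      -- (I) Lipschitz graph
      ((∀ t : ℝ, manifoldM Γ L Q T γ ρ σ t = Set.range (fun η : X => Q t η + Sig t (Q t η))) ∧
        (∀ (τ : ℝ) (η : X), Sig τ η = Sig τ (Q τ η)) ∧
        (∀ (τ : ℝ) (η : X), Sig τ η = Sig τ η - Q τ (Sig τ η)) ∧
        (∀ τ : ℝ, Sig τ 0 = 0) ∧
        (∀ (τ : ℝ) (η ξ : X),
          normS L γ τ (Sig τ η - Sig τ ξ) ≤ κ * normN L Q ρ τ (Q τ (η - ξ)))) ∧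
      -- (II) controlled growth of the unique global solution on the manifold
      (∀ (τ : ℝ) (η : X), η ∈ manifoldM Γ L Q T γ ρ σ τ →
        ∃ z : ℝ → X, IsGlobalSolution T z ∧ z τ = η ∧
          (∀ t : ℝ, z t ∈ manifoldM Γ L Q T γ ρ σ t) ∧
          HasBackwardGrowth Γ L Q γ ρ σ z τ ∧
          (∀ t : ℝ, t ≤ τ → adaptedNorm Γ L Q γ ρ t (z t) ≤
            Γ (1, κ) / Γ (1, 0) * Real.exp (-(ρ + L₁ * Γ (1, κ)) * (t - τ))
              * adaptedNorm Γ L Q γ ρ τ η) ∧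
          (∀ w : ℝ → X, IsGlobalSolution T w → w τ = η →
            ((∀ t : ℝ, w t ∈ manifoldM Γ L Q T γ ρ σ t) ∨ HasBackwardGrowth Γ L Q γ ρ σ w τ) →
            w = z)) ∧
      ∃ ω : ℝ,
        ω = γ - (γ - ρ) * L₂ * Γ (0, 1) / (γ - ρ - L₁ * Γ (1, κ)) ∧
        ω ∈ Set.Ioo ρ γ ∧
        -- (III) decay of the distance to the nonlinear projection
        (∀ (t τ : ℝ), τ ≤ t → ∀ η : X,
          normS L γ t (T t τ η - (Q t (T t τ η) + Sig t (T t τ η))) ≤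
            normS L γ τ (η - (Q τ η + Sig τ η)) * Real.exp (-ω * (t - τ))) ∧
        -- (IV) exponential control of bounded sets
        (∀ G : Set X, Bornology.IsBounded G → ∃ C : ℝ, 0 < C ∧ ∀ t τ : ℝ, τ ≤ t →
          semiDist (T t τ '' G) (manifoldM Γ L Q T γ ρ σ t)
            ≤ ENNReal.ofReal (C * Real.exp (-ω * (t - τ)))) ∧
        (0 < ω → IsInertialManifold Q T (manifoldM Γ L Q T γ ρ σ)) := by
  have H : IsSemilinear L Q M γ ρ Γ f L₁ L₂ T :=
    ⟨hL, hQ, hΓ, hf, hf0, hL₁, hL₂, hfN, hfS, hT, hVCF⟩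
  obtain ⟨κ, hκ, hκσ, hG⟩ := exists_isGap hΓ hL₁ hL₂ hσ hgap
  have hκ0 := hG.pos
  have hM := zero_le_bound hQ
  choose Z hZ hZ' hZQ using H.exists_globalSolution hG
  -- The graph map reads off the stable part, at time `τ`, of the unique solution with unstable part
  -- `Q τ η`.
  set Sig : ℝ → X → X := fun τ η => Z τ η τ - Q τ (Z τ η τ) with hSig
  have hZsig : ∀ τ η, Q τ η + Sig τ η = Z τ η τ := fun τ η => by
    simp only [hSig, ← hZQ τ η]
    exact add_sub_cancel _ _
  have hsub : ∀ τ η, η - (Q τ η + Sig τ η) - Q τ (η - (Q τ η + Sig τ η)) =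
      η - (Q τ η + Sig τ η) := fun τ η => by
    rw [hZsig, map_sub, hZQ, sub_self, sub_zero]
  have hZmem : ∀ τ η, Z τ η τ ∈ manifoldM Γ L Q T γ ρ σ τ := fun τ η =>
    ⟨_, hZ τ η, rfl, hZ' τ η⟩
  have hSigQ : ∀ τ η, Sig τ η = Sig τ (Q τ η) := fun τ η => by
    have := H.globalSolution_unique hG (hZ τ η) (hZ τ (Q τ η)) (hZ' τ η) (hZ' τ (Q τ η))
      (by rw [hZQ, hZQ, proj_proj hQ])
    simp only [hSig, this]
  have hSigproj : ∀ τ η, Sig τ η = Sig τ η - Q τ (Sig τ η) := fun τ η => by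
    simp [hSig, proj_proj hQ]
  have hrange : ∀ t, manifoldM Γ L Q T γ ρ σ t =
      Set.range (fun η : X => Q t η + Sig t (Q t η)) := by
    intro t
    ext η
    constructor
    · rintro ⟨z, hz, rfl, hz'⟩
      refine ⟨z t, ?_⟩
      simp only
      rw [← hSigQ, hZsig, H.globalSolution_unique hG (hZ t (z t)) hz (hZ' t (z t)) hz' (hZQ t _)]
    · rintro ⟨ξ, rfl⟩
      simp only
      rw [← hSigQ, hZsig]
      exact hZmem t ξ
  have hLip : ∀ (τ : ℝ) (η ξ : X),
      normS L γ τ (Sig τ η - Sig τ ξ) ≤ κ * normN L Q ρ τ (Q τ (η - ξ)) := by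
    intro τ η ξ
    have h := H.cone_estimate_global hG (hZ τ η) (hZ τ ξ) (hZ' τ η) (hZ' τ ξ)
    rw [unstableNorm_congr (y := η - ξ) (by rw [map_sub, map_sub, hZQ, hZQ])] at h
    rw [stableNorm, map_sub, sub_sub_sub_comm] at h
    exact h
  have hSig0 : ∀ τ, Sig τ 0 = 0 := by
    intro τ
    have := H.globalSolution_unique hG (hZ τ 0) H.isGlobalSolution_zero (hZ' τ 0)
      (H.hasBackwardGrowth_zero τ) (hZQ τ 0)
    simp [hSig, this]
  have hstable : ∀ τ η, normS L γ τ (η - (Q τ η + Sig τ η)) =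
      stableNorm L Q γ τ (η - Z τ η τ) := fun τ η => by
    rw [stableNorm, ← hZsig, hsub]
  set ω := γ - (L₂ + κ * L₁) * Γ (0, 1) with hω
  have hdecay : ∀ (t τ : ℝ), τ ≤ t → ∀ η : X,
      normS L γ t (T t τ η - (Q t (T t τ η) + Sig t (T t τ η))) ≤
        normS L γ τ (η - (Q τ η + Sig τ η)) * Real.exp (-ω * (t - τ)) := by
    intro t τ hτt η
    rw [hstable, hstable]
    -- The comparison solution changes with `s`: it always starts from the projection of the current
    -- state onto the manifold.
    have h := H.stableNorm_sub_le_exp hG (u := fun s => T s τ η) (Z := fun s => Z s (T s τ η)) hτt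
      ((H.isMildOn_process τ η).mono Set.Icc_subset_Ici_self) (fun s => hZ s _) (fun s => hZ' s _)
      (fun s => hZQ s _)
    simp only [hT.refl] at h
    exact h
  have hdist : ∀ G : Set X, Bornology.IsBounded G → ∃ C : ℝ, 0 < C ∧ ∀ t τ : ℝ, τ ≤ t →
      semiDist (T t τ '' G) (manifoldM Γ L Q T γ ρ σ t)
        ≤ ENNReal.ofReal (C * Real.exp (-ω * (t - τ))) := by
    intro G hGb
    obtain ⟨R, hR0, hR⟩ := hGb.exists_pos_norm_le
    -- `M R` bounds the stable norm of `η`, `κ M R` that of `Sig τ η`; the `+ 1` ensures strict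
    -- positivity.
    refine ⟨M * R + κ * (M * R) + 1, by positivity, fun t τ hτt => semiDist_image_le fun η hη => ?_⟩
    refine ⟨Z t (T t τ η) t, hZmem _ _, ?_⟩
    have h₁ := hdecay t τ hτt η
    have h₂ := norm_sub_proj_le_stableNorm hL hQ t (T t τ η - Z t (T t τ η) t)
    rw [map_sub, hZQ, sub_self, sub_zero] at h₂
    rw [← hstable] at h₂
    refine h₂.trans (h₁.trans ?_)
    gcongr
    have h₃ := hLip τ η 0
    rw [hSig0, sub_zero, sub_zero] at h₃
    have e : η - (Q τ η + Sig τ η) = η - Sig τ η - Q τ (η - Sig τ η) := by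
      have := hSigproj τ η
      rw [eq_comm, sub_eq_self] at this
      rw [map_sub, this]
      abel
    have h₄ : stableNorm L Q γ τ (Sig τ η) ≤ κ * (M * ‖η‖) := by
      rw [stableNorm, ← hSigproj]
      exact h₃.trans (mul_le_mul_of_nonneg_left (unstableNorm_le_norm hQ τ η) hκ0.le)
    have h₅ : M * ‖η‖ ≤ M * R := mul_le_mul_of_nonneg_left (hR η hη) hM
    have h₆ : κ * (M * ‖η‖) ≤ κ * (M * R) := mul_le_mul_of_nonneg_left h₅ hκ0.le
    have h₇ := stableNorm_add_le hQ τ η (-Sig τ η) (γ := γ)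
    rw [stableNorm_neg, ← sub_eq_add_neg] at h₇
    have h₈ := stableNorm_le_norm hQ τ η
    rw [e]
    change stableNorm L Q γ τ (η - Sig τ η) ≤ _
    linarith
  have hgraph : ∀ t, IsLipschitzGraph (Q t) (manifoldM Γ L Q T γ ρ σ t) := by
    intro t
    refine ⟨Sig t, (κ * M).toNNReal, LipschitzOnWith.of_dist_le_mul fun x _ y _ => ?_,
      fun x _ => ⟨Sig t x, (hSigproj t x).symm⟩, ?_⟩
    · rw [Real.coe_toNNReal _ (by positivity), dist_eq_norm, dist_eq_norm, mul_assoc]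
      have h₁ := norm_sub_proj_le_stableNorm hL hQ t (Sig t x - Sig t y)
      rw [stableNorm, map_sub, sub_sub_sub_comm, ← hSigproj, ← hSigproj] at h₁
      exact h₁.trans ((hLip t x y).trans
        (mul_le_mul_of_nonneg_left (unstableNorm_le_norm hQ t _) hκ0.le))
    · rw [hrange, ← Set.range_comp]
      rfl
  have hinv : IsInvariantManifoldWith Q T (manifoldM Γ L Q T γ ρ σ) ω := by
    refine ⟨fun t τ h => H.manifoldM_invariant h, fun U hU => ?_, hgraph⟩
    obtain ⟨C, hC0, hC⟩ := hdist U hU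
    exact ⟨0, le_rfl, C, hC0, fun t τ h => hC t τ (sub_nonneg.1 h)⟩
  refine ⟨⟨ω, hinv⟩, κ, hκ, hκσ, Sig, ⟨hrange, hSigQ, hSigproj, hSig0, hLip⟩, ?_, ω,
    hG.exponent_eq.symm, ⟨?_, ?_⟩, hdecay, hdist, fun hω0 => ⟨ω, hω0, hinv⟩⟩
  · rintro τ _ ⟨z, hz, rfl, hz'⟩
    refine ⟨z, hz, rfl, H.mem_manifoldM_of_globalSolution hz hz', hz',
      fun t ht => H.adaptedNorm_backward_le hG hz hz' ht, fun w hw hwτ hor => ?_⟩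
    rcases hor with hwM | hw'
    · exact H.globalSolution_unique_of_mem hG hz hz' hw hwτ hwM
    · exact H.globalSolution_unique hG hw hz hw' hz' (by rw [hwτ])
  · linarith [hG.attraction]
  · have : 0 < (L₂ + κ * L₁) * Γ (0, 1) := mul_pos (by positivity) hΓ.pos_zero_one
    linarith
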